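/- Let $B^3=\{(x,y,z)\in\mathbb R^3 : x^2+y^2+z^2\le 2\}\subset\hat{\mathbb R}^3=\mathbb R^3\cup\{\infty\}\cong S^3$, with marked boundary points $\mathrm{SW}=(-1,-1,0)$, $\mathrm{SE}=(1,-1,0)$, $\mathrm{NE}=(1,1,0)$, $\mathrm{NW}=(-1,1,0)$. Let $\mathcal J$ be the group generated by the $\pi$-rotations of $\mathbb R^2$ about the points of $\mathbb Z^2$. Embed the pillowcase $\mathbb R^2/\mathcal J$ in $B^3$ by $$(u,v)\mapsto(-\cos\pi u,\,-\cos\pi v,\,\sin\pi u\,\sin\pi v),$$ so that it meets $\partial B^3$ exactly in the images of $\mathbb Z^2$, which are the four marked points. For $r\in\hat{\mathbb Q}=\mathbb Q\cup\{\infty\}$, the rational tangle of slope $r$ is $(B^3,t(r))$, where $t(r)$ is the pair of arcs that is the image of the lines of slope $r$ in $\mathbb R^2$ through points of $\mathbb Z^2$. The 2-bridge link of slope $r$ is $K(r)=t(r)\cup\iota(t(\infty))\subset\hat{\mathbb R}^3\cong S^3$, where $\iota$ is the inversion of $\hat{\mathbb R}^3$ in $\partial B^3$. The rational link $K_P(r)$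 in projective space $P^3=B^3/(x\sim -x,\ x\in\partial B^3)$ is the image of $t(r)$. Its covering link $\tilde K_P(r)$ is its inverse image under the universal covering $S^3\to P^3$, given by the quotient map on $B^3$ and, outside $B^3$, by $x\mapsto[-\iota(x)]$. Two links in $S^3$ are equivalent if some orientation-preserving homeomorphism of $S^3$ maps one onto the other. Let $\mathcal D$ be the Farey tessellation of the hyperbolic plane, obtained from the ideal triangle with vertices $0,1,\infty$ by repeated reflection in edges, and let $\operatorname{Aut}^+(\mathcal D)$ be its group of orientation-preserving automorphisms, which acts on the ideal boundary $\mathbb R\cup\{\infty\}$. Proposition. Let $r\in\hat{\mathbb Q}$ (with $-\infty=\infty$). There is an $\eta\in\operatorname{Aut}^+(\mathcal D)$ with $\eta(-r)=\infty$. For every such $\eta$, the point $\tilde r=\eta(r)$ lies in $\hat{\mathbb Q}$, and the covering link $\tilde K_P(r)$ of $K_P(r)$ is equivalent to the 2-bridge link $K(\tilde r)$. -/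

import Mathlib

open CategoryTheory OnePoint Pointwise

noncomputable section

namespace RationalLink

/-! ### The 3-sphere, links and equivalence -/

/-- Euclidean 3-space. -/
abbrev E3 : Type := EuclideanSpace ℝ (Fin 3)

/-- The 3-sphere, as the one-point compactification of Euclidean 3-space. -/
abbrev S3 : Type := OnePoint E3

/-- A self-homeomorphism of the 3-sphere is orientation-preserving if it acts trivially on
`H₃(S³; ℤ)` (singular homology), i.e. if it fixes the fundamental class. -/
def OrientationPreserving (φ : S3 ≃ₜ S3) : Prop :=
  ((AlgebraicTopology.singularHomologyFunctor (ModuleCat.{0} ℤ) 3).obj (ModuleCat.of ℤ ℤ)).map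
    (TopCat.ofHom (φ : C(S3, S3))) = 𝟙 _

/-- Equivalence of (unoriented) links in the 3-sphere: there is an orientation-preserving
homeomorphism of the 3-sphere that maps one to the other. -/
def LinkEquivalent (L L' : Set S3) : Prop :=
  ∃ φ : S3 ≃ₜ S3, OrientationPreserving φ ∧ φ '' L = L'

/-! ### Rational tangles -/

/-- The round ball `x² + y² + z² ≤ 2`. -/
abbrev B3 : Type := Metric.closedBall (0 : E3) √2

/-- The union of the lines of slope `r` in the plane that pass through points of `ℤ²`. -/
def latticeLines : OnePoint ℚ → Set (ℝ × ℝ)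
  | ∞ => {w | ∃ m : ℤ, w.1 = m}
  | (s : ℚ) => {w | ∃ m n : ℤ, w.2 - n = (s : ℝ) * (w.1 - m)}

/-- The pillowcase in `ℝ³`, parametrized by the plane. -/
def pillowE (w : ℝ × ℝ) : E3 :=
  !₂[-Real.cos (Real.pi * w.1), -Real.cos (Real.pi * w.2),
    Real.sin (Real.pi * w.1) * Real.sin (Real.pi * w.2)]

/-- The squared norm on the pillowcase; it equals `2` exactly at the images of lattice points. -/
theorem norm_sq_pillowE (w : ℝ × ℝ) :
    ‖pillowE w‖ ^ 2 = 1 + Real.cos (Real.pi * w.1) ^ 2 * Real.cos (Real.pi * w.2) ^ 2 := by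
  rw [EuclideanSpace.norm_sq_eq, Fin.sum_univ_three]
  simp only [pillowE, PiLp.toLp_apply, Matrix.cons_val_zero, Matrix.cons_val_one, Matrix.cons_val,
    Real.norm_eq_abs, sq_abs]
  have h1 := Real.sin_sq_add_cos_sq (Real.pi * w.1)
  have h2 := Real.sin_sq_add_cos_sq (Real.pi * w.2)
  rw [mul_pow, eq_sub_of_add_eq h1, eq_sub_of_add_eq h2]
  ring

theorem pillowE_mem (w : ℝ × ℝ) : pillowE w ∈ Metric.closedBall (0 : E3) √2 := by
  rw [mem_closedBall_zero_iff]
  apply Real.le_sqrt_of_sq_le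
  rw [norm_sq_pillowE]
  have h1 := Real.cos_sq_le_one (Real.pi * w.1)
  have h2 := Real.cos_sq_le_one (Real.pi * w.2)
  nlinarith [sq_nonneg (Real.cos (Real.pi * w.1)), sq_nonneg (Real.cos (Real.pi * w.2))]

/-- The pillowcase `(ℝ², ℤ²)/𝓙`, where `𝓙` is generated by the `π`-rotations about the points of
`ℤ²`, realized in the ball: two points of the plane have the same image if and only if they are
in the same `𝓙`-orbit. The pillowcase meets the boundary sphere exactly in the images of the
lattice points, which are the four marked points `(0,0) ↦ SW = (-1,-1,0)`,
`(1,0) ↦ SE = (1,-1,0)`, `(1,1) ↦ NE = (1,1,0)`, `(0,1) ↦ NW = (-1,1,0)`; the unit square is the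
front face `z ≥ 0`. Radial projection from the origin maps it homeomorphically onto the
boundary sphere. -/
def pillow (w : ℝ × ℝ) : B3 := ⟨pillowE w, pillowE_mem w⟩

/-- The pair of arcs `t(r)` of the rational tangle `(B³, t(r))` of slope `r`: the two arcs of
slope `r` on the pillowcase. -/
def tangle (r : OnePoint ℚ) : Set B3 := pillow '' latticeLines r

/-! ### 2-bridge links -/

/-- The inversion of the 3-sphere `ℝ³ ∪ {∞}` in the boundary of the ball. -/
def inv3 : S3 → S3
  | ∞ => ((0 : E3) : S3)
  | (x : E3) => open Classical in
      if x = 0 then ∞ else ((EuclideanGeometry.inversion (0 : E3) √2 x : E3) : S3)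

/-- The inclusion of the ball into the 3-sphere. -/
def ballIncl (x : B3) : S3 := ((x : E3) : S3)

/-- The 2-bridge link `K(r) = t(r) ∪ ι(t(∞))`. -/
def twoBridge (r : OnePoint ℚ) : Set S3 :=
  ballIncl '' tangle r ∪ inv3 '' (ballIncl '' tangle ∞)

/-! ### Projective 3-space and its universal cover -/

/-- The identification of antipodal points on the boundary of the ball. -/
def antipodalSetoid : Setoid B3 where
  r x y := x = y ∨ (‖(x : E3)‖ = √2 ∧ (y : E3) = -(x : E3))
  iseqv :=
    { refl := fun _ => Or.inl rfl
      symm := by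
        rintro x y (h | ⟨h, h'⟩)
        · exact Or.inl h.symm
        · exact Or.inr ⟨by rw [h', norm_neg, h], by rw [h', neg_neg]⟩
      trans := by
        rintro x y z (rfl | ⟨h, h'⟩) (rfl | ⟨k, k'⟩)
        · exact Or.inl rfl
        · exact Or.inr ⟨k, k'⟩
        · exact Or.inr ⟨h, h'⟩
        · exact Or.inl (Subtype.ext (by rw [k', h', neg_neg])) }

/-- Projective 3-space, with the quotient topology. -/
abbrev P3 : Type := Quotient antipodalSetoid

/-- The quotient map from the ball to projective 3-space. -/
def toP3 : B3 → P3 := Quotient.mk antipodalSetoid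

/-- The rational link `K_P(r)` of slope `r` in projective 3-space. -/
def rationalLinkP (r : OnePoint ℚ) : Set P3 := toP3 '' tangle r

theorem neg_inversion_mem {x : E3} (h : ¬ ‖x‖ ≤ √2) :
    -EuclideanGeometry.inversion (0 : E3) √2 x ∈ Metric.closedBall (0 : E3) √2 := by
  have h0 : 0 < √2 := by positivity
  have hx : 0 < ‖x‖ := h0.trans (not_le.mp h)
  have := EuclideanGeometry.dist_inversion_center (0 : E3) x √2
  rw [dist_zero_right, dist_zero_right] at this
  rw [mem_closedBall_zero_iff, norm_neg, this, div_le_iff₀ hx, sq]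
  exact mul_le_mul_of_nonneg_left (not_le.mp h).le h0.le

/-- The universal covering of projective 3-space by the 3-sphere: on the ball it is the quotient
map, and outside it is the composition of the quotient map with the free involution
"inversion in the boundary of the ball, followed by the antipodal map". -/
def coveringProj : S3 → P3
  | ∞ => toP3 ⟨0, Metric.mem_closedBall_self (Real.sqrt_nonneg 2)⟩
  | (x : E3) => open Classical in
      if h : ‖x‖ ≤ √2 then toP3 ⟨x, mem_closedBall_zero_iff.mpr h⟩
      else toP3 ⟨-EuclideanGeometry.inversion (0 : E3) √2 x, neg_inversion_mem h⟩

/-! The map `coveringProj` is indeed a two-fold covering map. -/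

/-- The free involution of the 3-sphere: inversion, followed by the antipodal map. -/
def deck (x : S3) : S3 := (inv3 x).map (fun y : E3 => -y)

theorem deck_infty : deck ∞ = ((0 : E3) : S3) := by
  simp [deck, inv3]

theorem deck_zero : deck ((0 : E3) : S3) = ∞ := by
  simp [deck, inv3]

theorem deck_coe {x : E3} (hx : x ≠ 0) :
    deck (x : S3) = ((-EuclideanGeometry.inversion (0 : E3) √2 x : E3) : S3) := by
  simp [deck, inv3, hx]

theorem inversion_neg' (x : E3) : EuclideanGeometry.inversion (0 : E3) √2 (-x) =
    -EuclideanGeometry.inversion (0 : E3) √2 x := by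
  simp [EuclideanGeometry.inversion]

theorem norm_inversion' (x : E3) :
    ‖EuclideanGeometry.inversion (0 : E3) √2 x‖ = 2 / ‖x‖ := by
  have := EuclideanGeometry.dist_inversion_center (0 : E3) x √2
  rwa [dist_zero_right, dist_zero_right, Real.sq_sqrt (by norm_num)] at this

theorem deck_deck (x : S3) : deck (deck x) = x := by
  have h2 : √2 ≠ 0 := by positivity
  induction x using OnePoint.rec with
  | infty => rw [deck_infty, deck_zero]
  | coe x =>
    by_cases hx : x = 0
    · rw [hx, deck_zero, deck_infty]
    · have h3 : -EuclideanGeometry.inversion (0 : E3) √2 x ≠ 0 := by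
        rw [neg_ne_zero]
        exact fun h => hx ((EuclideanGeometry.inversion_eq_center h2).mp h)
      rw [deck_coe hx, deck_coe h3, inversion_neg', neg_neg,
        EuclideanGeometry.inversion_inversion _ h2]

theorem deck_ne (x : S3) : deck x ≠ x := by
  induction x using OnePoint.rec with
  | infty => rw [deck_infty]; exact OnePoint.coe_ne_infty _
  | coe x =>
    by_cases hx : x = 0
    · rw [hx, deck_zero]; exact OnePoint.infty_ne_coe _
    · rw [deck_coe hx, Ne, OnePoint.coe_eq_coe]
      intro h
      have hn : ‖EuclideanGeometry.inversion (0 : E3) √2 x‖ = ‖x‖ := by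
        rw [← norm_neg, h]
      rw [norm_inversion'] at hn
      have hpos : 0 < ‖x‖ := norm_pos_iff.mpr hx
      have hs : x ∈ Metric.sphere (0 : E3) √2 := by
        rw [mem_sphere_zero_iff_norm]
        rw [div_eq_iff hpos.ne'] at hn
        rw [hn, Real.sqrt_mul_self hpos.le]
      rw [EuclideanGeometry.inversion_of_mem_sphere hs] at h
      have h' : (2 : ℝ) • x = 0 := by
        rw [two_smul]
        nth_rewrite 1 [← h]
        exact neg_add_cancel x
      exact hx ((smul_eq_zero.mp h').resolve_left two_ne_zero)

theorem continuous_deck : Continuous deck := by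
  have h2 : √2 ≠ 0 := by positivity
  rw [continuous_iff_continuousAt]
  intro x
  induction x using OnePoint.rec with
  | infty =>
    rw [OnePoint.continuousAt_infty', deck_infty, Filter.coclosedCompact_eq_cocompact,
      ← Metric.cobounded_eq_cocompact]
    have h : Filter.Tendsto (fun x : E3 => -EuclideanGeometry.inversion (0 : E3) √2 x)
        (Bornology.cobounded E3) (nhds 0) := by
      rw [tendsto_zero_iff_norm_tendsto_zero]
      simp only [norm_neg, norm_inversion']
      exact tendsto_norm_cobounded_atTop.const_div_atTop 2
    refine Filter.Tendsto.congr' ?_ ((OnePoint.continuous_coe.tendsto (0 : E3)).comp h)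
    filter_upwards [Bornology.eventually_ne_cobounded (0 : E3)] with x hx
    exact (deck_coe hx).symm
  | coe x =>
    rw [OnePoint.continuousAt_coe]
    by_cases hx : x = 0
    · subst hx
      have key : Filter.Tendsto (deck ∘ ((↑) : E3 → S3)) (nhdsWithin 0 {0}ᶜ) (nhds ∞) := by
        have h := (EuclideanGeometry.tendsto_inversion_nhdsNE_center_cobounded
          (c := (0 : E3)) h2)
        have h' := (Filter.tendsto_neg_cobounded).comp h
        rw [Metric.cobounded_eq_cocompact, ← Filter.coclosedCompact_eq_cocompact] at h'
        refine Filter.Tendsto.congr' ?_ (OnePoint.tendsto_coe_infty.comp h')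
        filter_upwards [self_mem_nhdsWithin] with x hx
        exact (deck_coe hx).symm
      rw [continuousAt_iff_punctured_nhds]
      simpa only [Function.comp_apply, deck_zero] using key
    · have h : ContinuousAt (fun x : E3 => -EuclideanGeometry.inversion (0 : E3) √2 x) x :=
        (ContinuousAt.inversion continuousAt_const continuousAt_const continuousAt_id hx).neg
      refine ContinuousAt.congr (OnePoint.continuous_coe.continuousAt.comp h) ?_
      filter_upwards [isOpen_ne.mem_nhds hx] with y hy
      exact (deck_coe hy).symm

theorem coveringProj_ballIncl (x : B3) : coveringProj (ballIncl x) = toP3 x := by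
  have hx : ‖(x : E3)‖ ≤ √2 := mem_closedBall_zero_iff.mp x.2
  change (if h : ‖(x : E3)‖ ≤ √2 then toP3 ⟨x, mem_closedBall_zero_iff.mpr h⟩ else _) = _
  rw [dif_pos hx]

theorem coveringProj_infty :
    coveringProj ∞ = toP3 ⟨0, Metric.mem_closedBall_self (Real.sqrt_nonneg 2)⟩ := rfl

theorem coveringProj_out {x : E3} (h : ¬ ‖x‖ ≤ √2) : coveringProj (x : S3) =
    toP3 ⟨-EuclideanGeometry.inversion (0 : E3) √2 x, neg_inversion_mem h⟩ := by
  change (if h : ‖(x : E3)‖ ≤ √2 then _ else _) = _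
  rw [dif_neg h]

/-- Every point of the 3-sphere, or its image under the involution, lies in the ball. -/
theorem mem_ball_or (x : S3) : (∃ y, x = ballIncl y) ∨
    ∃ y, deck x = ballIncl y ∧ coveringProj x = toP3 y := by
  induction x using OnePoint.rec with
  | infty => exact Or.inr ⟨⟨0, Metric.mem_closedBall_self (Real.sqrt_nonneg 2)⟩, deck_infty, rfl⟩
  | coe x =>
    by_cases h : ‖x‖ ≤ √2
    · exact Or.inl ⟨⟨x, mem_closedBall_zero_iff.mpr h⟩, rfl⟩
    · have hx : x ≠ 0 := by
        rintro rfl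
        exact h (by simp)
      exact Or.inr ⟨⟨_, neg_inversion_mem h⟩, deck_coe hx, coveringProj_out h⟩

theorem toP3_eq_iff {x y : B3} :
    toP3 x = toP3 y ↔ x = y ∨ (‖(x : E3)‖ = √2 ∧ (y : E3) = -(x : E3)) :=
  Quotient.eq (r := antipodalSetoid)

theorem ballIncl_injective : Function.Injective ballIncl := fun _ _ h =>
  Subtype.ext (OnePoint.coe_injective h)

/-- Two points of the ball are exchanged by the involution exactly if they are antipodal points
of the boundary. -/
theorem deck_ballIncl_iff {x y : B3} :
    deck (ballIncl x) = ballIncl y ↔ ‖(x : E3)‖ = √2 ∧ (y : E3) = -(x : E3) := by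
  have hx : ‖(x : E3)‖ ≤ √2 := mem_closedBall_zero_iff.mp x.2
  have hy : ‖(y : E3)‖ ≤ √2 := mem_closedBall_zero_iff.mp y.2
  have h2 : (0 : ℝ) < √2 := by positivity
  by_cases h0 : (x : E3) = 0
  · simp only [ballIncl, h0, deck_zero, norm_zero]
    constructor
    · intro h
      exact absurd h (OnePoint.infty_ne_coe _)
    · rintro ⟨h, -⟩
      exact absurd h h2.ne
  · have hpos : 0 < ‖(x : E3)‖ := norm_pos_iff.mpr h0
    simp only [ballIncl, deck_coe h0, OnePoint.coe_eq_coe]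
    constructor
    · intro h
      have hn : ‖(y : E3)‖ = 2 / ‖(x : E3)‖ := by rw [← h, norm_neg, norm_inversion']
      rw [hn, div_le_iff₀ hpos] at hy
      have h22 : √2 * √2 = 2 := Real.mul_self_sqrt (by norm_num)
      have hx' : ‖(x : E3)‖ = √2 := le_antisymm hx (by nlinarith)
      refine ⟨hx', ?_⟩
      rw [← h, EuclideanGeometry.inversion_of_mem_sphere (mem_sphere_zero_iff_norm.mpr hx')]
    · rintro ⟨hx', h⟩
      rw [EuclideanGeometry.inversion_of_mem_sphere (mem_sphere_zero_iff_norm.mpr hx'), h]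

theorem coveringProj_deck (x : S3) : coveringProj (deck x) = coveringProj x := by
  rcases mem_ball_or x with ⟨y, rfl⟩ | ⟨y, hy, hxy⟩
  · rcases mem_ball_or (deck (ballIncl y)) with ⟨z, hz⟩ | ⟨z, hz, hyz⟩
    · rw [hz, coveringProj_ballIncl, coveringProj_ballIncl, eq_comm, toP3_eq_iff]
      exact Or.inr (deck_ballIncl_iff.mp hz)
    · rw [deck_deck] at hz
      rw [hyz, coveringProj_ballIncl, ballIncl_injective hz]
  · rw [hy, coveringProj_ballIncl, hxy]

theorem coveringProj_eq_iff {x y : S3} :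
    coveringProj x = coveringProj y ↔ x = y ∨ x = deck y := by
  have key : ∀ {x y : B3}, toP3 x = toP3 y →
      ballIncl x = ballIncl y ∨ ballIncl x = deck (ballIncl y) := by
    intro x y h
    rcases toP3_eq_iff.mp h with rfl | h
    · exact Or.inl rfl
    · right
      rw [← deck_ballIncl_iff.mpr h, deck_deck]
  constructor
  · intro h
    rcases mem_ball_or x with ⟨a, rfl⟩ | ⟨a, ha, hxa⟩ <;>
      rcases mem_ball_or y with ⟨b, rfl⟩ | ⟨b, hb, hyb⟩
    · rw [coveringProj_ballIncl, coveringProj_ballIncl] at h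
      exact key h
    · rw [coveringProj_ballIncl, hyb] at h
      have hb' : y = deck (ballIncl b) := by rw [← hb, deck_deck]
      rw [hb', deck_deck]
      exact (key h).symm
    · rw [coveringProj_ballIncl, hxa] at h
      have ha' : x = deck (ballIncl a) := by rw [← ha, deck_deck]
      rw [ha']
      rcases key h with h | h
      · exact Or.inr (by rw [h])
      · exact Or.inl (by rw [h, deck_deck])
    · rw [hyb, hxa] at h
      have ha' : x = deck (ballIncl a) := by rw [← ha, deck_deck]
      have hb' : y = deck (ballIncl b) := by rw [← hb, deck_deck]
      rw [ha', hb', deck_deck]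
      rcases key h with h | h
      · exact Or.inl (by rw [h])
      · exact Or.inr (by rw [h, deck_deck])
  · rintro (rfl | rfl)
    · rfl
    · exact coveringProj_deck y

theorem isClosedEmbedding_ballIncl : Topology.IsClosedEmbedding ballIncl := by
  have : CompactSpace B3 := isCompact_iff_compactSpace.mp (isCompact_closedBall _ _)
  exact Continuous.isClosedEmbedding
    (OnePoint.continuous_coe.comp continuous_subtype_val) ballIncl_injective

theorem continuous_coveringProj : Continuous coveringProj := by
  have hA : ContinuousOn coveringProj (Set.range ballIncl) := by
    rw [continuousOn_iff_continuous_domRestrict]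
    rw [← isClosedEmbedding_ballIncl.isEmbedding.toHomeomorph.comp_continuous_iff']
    have : Set.domRestrict (Set.range ballIncl) coveringProj ∘
        isClosedEmbedding_ballIncl.isEmbedding.toHomeomorph = toP3 := by
      funext x
      exact coveringProj_ballIncl x
    rw [this]
    exact continuous_quotient_mk'
  have hB : ContinuousOn coveringProj (deck ⁻¹' Set.range ballIncl) := by
    have h := hA.comp continuous_deck.continuousOn (Set.mapsTo_preimage deck _)
    exact h.congr fun x _ => (coveringProj_deck x).symm
  have hAB : Set.range ballIncl ∪ deck ⁻¹' Set.range ballIncl = Set.univ := by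
    refine Set.eq_univ_of_forall fun x => ?_
    rcases mem_ball_or x with ⟨y, rfl⟩ | ⟨y, hy, -⟩
    · exact Or.inl ⟨y, rfl⟩
    · exact Or.inr ⟨y, hy.symm⟩
  rw [← continuousOn_univ, ← hAB]
  exact hA.union_of_isClosed hB isClosedEmbedding_ballIncl.isClosed_range
    (isClosedEmbedding_ballIncl.isClosed_range.preimage continuous_deck)

theorem isCoveringMap_coveringProj : IsCoveringMap coveringProj := by
  let _ : MulAction ℤˣ S3 :=
    { smul := fun u x => if u = 1 then x else deck x
      one_smul := fun x => if_pos rfl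
      mul_smul := by
        intro u v x
        change (if u * v = 1 then x else deck x) =
          if u = 1 then (if v = 1 then x else deck x) else deck (if v = 1 then x else deck x)
        rcases Int.units_eq_one_or u with rfl | rfl <;>
          rcases Int.units_eq_one_or v with rfl | rfl <;> simp [deck_deck] }
  have hneg : ∀ x : S3, (-1 : ℤˣ) • x = deck x := fun x => if_neg (by decide)
  have hq : Topology.IsQuotientMap coveringProj := by
    refine Topology.IsQuotientMap.of_comp (f := ballIncl) isClosedEmbedding_ballIncl.continuous
      continuous_coveringProj ?_
    have : coveringProj ∘ ballIncl = toP3 := funext coveringProj_ballIncl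
    rw [this]
    exact isQuotientMap_quotient_mk'
  have h : IsQuotientCoveringMap coveringProj ℤˣ :=
    { hq with
      continuous_const_smul := by
        intro u
        rcases Int.units_eq_one_or u with rfl | rfl
        · simpa only [one_smul] using continuous_id'
        · simpa only [hneg] using continuous_deck
      apply_eq_iff_mem_orbit := by
        intro x y
        rw [coveringProj_eq_iff]
        constructor
        · rintro (rfl | rfl)
          · exact MulAction.mem_orbit_self _
          · exact ⟨-1, hneg y⟩
        · rintro ⟨u, rfl⟩
          rcases Int.units_eq_one_or u with rfl | rfl
          · exact Or.inl (one_smul _ _)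
          · exact Or.inr (hneg y)
      disjoint := by
        intro x
        obtain ⟨U, V, hU, hV, hxU, hxV, hUV⟩ := t2_separation (deck_ne x).symm
        refine ⟨U ∩ deck ⁻¹' V, (hU.inter (hV.preimage continuous_deck)).mem_nhds ⟨hxU, hxV⟩, ?_⟩
        intro u hu
        rcases Int.units_eq_one_or u with rfl | rfl
        · rfl
        · obtain ⟨_, ⟨y, hy, rfl⟩, hy'⟩ := hu
          simp only [hneg] at hy'
          exact absurd rfl (hUV.ne_of_mem hy'.1 hy.2) }
  exact h.isCoveringMap

/-- The covering link of `K_P(r)`: its inverse image in the universal cover. -/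
def coveringLink (r : OnePoint ℚ) : Set S3 := coveringProj ⁻¹' rationalLinkP r

/-! ### The Farey tessellation

The group `GL (Fin 2) ℝ` acts on the hyperbolic plane by isometries (matrices of negative
determinant acting by orientation-reversing ones) and on its ideal boundary `OnePoint ℝ`. An ideal
triangle is given by the set of its three ideal vertices. -/

/-- `g` acts on the hyperbolic plane as the reflection in the geodesic with ideal endpoints
`a ≠ b`: it is an orientation-reversing involution that fixes both endpoints. -/
def IsReflection (g : GL (Fin 2) ℝ) (a b : OnePoint ℝ) : Prop :=
  g.det.val < 0 ∧ (∀ x : OnePoint ℝ, g • g • x = x) ∧ g • a = a ∧ g • b = b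

/-- The ideal triangles of the Farey tessellation: those obtained from the ideal triangle with
vertices `0, 1, ∞` by repeated reflection in the edges. -/
inductive IsFareyTriangle : Set (OnePoint ℝ) → Prop
  | base : IsFareyTriangle {((0 : ℝ) : OnePoint ℝ), ((1 : ℝ) : OnePoint ℝ), ∞}
  | reflect {T : Set (OnePoint ℝ)} {a b : OnePoint ℝ} {g : GL (Fin 2) ℝ}
      (hT : IsFareyTriangle T) (ha : a ∈ T) (hb : b ∈ T) (hab : a ≠ b) (hg : IsReflection g a b) :
      IsFareyTriangle (g • T)

/-- The orientation-preserving automorphisms of the Farey tessellation: the matrices of positive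
determinant whose action on the hyperbolic plane permutes the triangles of the tessellation. -/
def fareyAutPos : Subgroup (GL (Fin 2) ℝ) :=
  MulAction.stabilizer (GL (Fin 2) ℝ) {T : Set (OnePoint ℝ) | IsFareyTriangle T} ⊓
    Matrix.GLPos (Fin 2) ℝ

/-- The inclusion of `ℚ ∪ {∞}` into the ideal boundary `ℝ ∪ {∞}` of the hyperbolic plane. -/
def ideal (r : OnePoint ℚ) : OnePoint ℝ := r.map (fun s : ℚ => (s : ℝ))

/-- The slope `-r`, with `-∞ = ∞`. -/
def negSlope (r : OnePoint ℚ) : OnePoint ℚ := r.map (fun s => -s)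

end RationalLink

end

/-!
The antipodal map of `ℝ³` induces the map `(u, v) ↦ (1 - u, 1 + v)` on the pillowcase, which negates
slopes. Hence the covering link is the union `t(r) ∪ ι(t(-r))` of two rational tangles, where `ι` is
the inversion in the boundary of the ball (`coveringLink_eq`). An element `A` of the modular group
acts on the plane and on the pillowcase. It is enough to extend this action to an
orientation-preserving homeomorphism of the 3-sphere that commutes with `ι` on the pillowcase
(`exists_realizes`): if `A` maps `-r` to `∞`, this homeomorphism maps `t(r) ∪ ι(t(-r))` to
`t(A r) ∪ ι(t(∞))`, a 2-bridge link (`linkEquivalent_of_smul`).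

Construction of the extension. The pillowcase is the unit sphere of the norm `gauge`, so a self-map
of the pillowcase extends to a self-map `f` of `ℝ³` that is homogeneous on rays. On each ray, `f` is
then corrected by the piecewise linear map `radial`, so that it respects the inverted pillowcase,
too; this gives `spread f`. The pillowcase touches its inverted copy at the four marked points, and
continuity there holds because the correction is bounded by the distance of the two surfaces.

The modular group is generated by the transvection `(u, v) ↦ (u + v, v)` and its conjugate by the
reflection that interchanges `u` and `v`. The former is induced by `shear`, which acts on each section
of the pillowcase with constant second coordinate as a linear map of determinant one. Linear
interpolation shows that `spread shear` is homotopic to `shear`, to a quarter turn, and to the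
identity, so it acts trivially on homology. Conjugation by any homeomorphism preserves this property.

On the arithmetic side, every Farey triangle is the image of the base triangle under the modular
group (`IsFareyTriangle.exists_eq_smul`), because a reflection in an edge of the base triangle has
trace zero and so is determined. An orientation-preserving Möbius transformation that preserves the
base triangle acts as one of its three rotations, so every orientation-preserving automorphism of
the tessellation acts on the ideal boundary as an element of the modular group
(`exists_mapGL_smul_eq`).
-/

noncomputable section

namespace RationalLink

open scoped MatrixGroups

/-! ### Orientation-preserving homeomorphisms -/

/-- Homotopy invariance of singular homology. -/
theorem orientationPreserving_of_homotopic {φ : S3 ≃ₜ S3}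
    (h : (φ : C(S3, S3)).Homotopic (ContinuousMap.id S3)) : OrientationPreserving φ := by
  obtain ⟨H⟩ := h
  have H' : TopCat.Homotopy (TopCat.ofHom (φ : C(S3, S3))) (𝟙 (TopCat.of S3)) := H
  have := H'.congr_homologyMap_singularChainComplexFunctor (ModuleCat.of ℤ ℤ) 3
  rw [CategoryTheory.Functor.map_id, HomologicalComplex.homologyMap_id] at this
  exact this

theorem OrientationPreserving.trans {φ ψ : S3 ≃ₜ S3} (hφ : OrientationPreserving φ)
    (hψ : OrientationPreserving ψ) : OrientationPreserving (φ.trans ψ) := by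
  unfold OrientationPreserving at *
  have : TopCat.ofHom ((φ.trans ψ : S3 ≃ₜ S3) : C(S3, S3)) =
      TopCat.ofHom (φ : C(S3, S3)) ≫ TopCat.ofHom (ψ : C(S3, S3)) := rfl
  rw [this, Functor.map_comp, hφ, hψ, Category.comp_id]

/-- Any homeomorphism `σ` conjugates orientation-preserving homeomorphisms to
orientation-preserving ones, even if `σ` itself reverses the orientation. -/
theorem OrientationPreserving.conj {φ : S3 ≃ₜ S3} (hφ : OrientationPreserving φ)
    (σ : S3 ≃ₜ S3) : OrientationPreserving ((σ.trans φ).trans σ.symm) := by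
  unfold OrientationPreserving at *
  have : TopCat.ofHom (((σ.trans φ).trans σ.symm : S3 ≃ₜ S3) : C(S3, S3)) =
      (TopCat.ofHom (σ : C(S3, S3)) ≫ TopCat.ofHom (φ : C(S3, S3))) ≫
        TopCat.ofHom (σ.symm : C(S3, S3)) := rfl
  have h1 : TopCat.ofHom (σ : C(S3, S3)) ≫ TopCat.ofHom (σ.symm : C(S3, S3)) =
      𝟙 (TopCat.of S3) := by
    ext x
    exact σ.symm_apply_apply x
  rw [this, Functor.map_comp, Functor.map_comp, hφ, Category.comp_id, ← Functor.map_comp, h1,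
    CategoryTheory.Functor.map_id]

theorem OrientationPreserving.refl : OrientationPreserving (Homeomorph.refl S3) :=
  orientationPreserving_of_homotopic (ContinuousMap.Homotopic.refl _)

theorem OrientationPreserving.symm {φ : S3 ≃ₜ S3} (hφ : OrientationPreserving φ) :
    OrientationPreserving φ.symm := by
  unfold OrientationPreserving at *
  have h1 : TopCat.ofHom (φ : C(S3, S3)) ≫ TopCat.ofHom (φ.symm : C(S3, S3)) =
      𝟙 (TopCat.of S3) := by
    ext x
    exact φ.symm_apply_apply x
  have h2 := congrArg (((AlgebraicTopology.singularHomologyFunctor (ModuleCat.{0} ℤ) 3).obj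
    (ModuleCat.of ℤ ℤ)).map) h1
  rwa [Functor.map_comp, hφ, Category.id_comp, CategoryTheory.Functor.map_id] at h2

/-- A continuous family of self-maps of `ℝ³` that expand norms at least by a uniform positive factor
extends continuously to the one-point compactification. -/
theorem continuous_map_family {X : Type*} [TopologicalSpace X] {h : X → E3 → E3}
    (hc : Continuous fun p : X × E3 => h p.1 p.2) {C : ℝ} (hC : ∀ t x, ‖x‖ ≤ C * ‖h t x‖) :
    Continuous fun p : X × S3 => OnePoint.map (h p.1) p.2 := by
  have hC' : ∀ t x, ‖x‖ ≤ (|C| + 1) * ‖h t x‖ := fun t x =>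
    (hC t x).trans (mul_le_mul_of_nonneg_right (by linarith [le_abs_self C]) (norm_nonneg _))
  have hpos : 0 < |C| + 1 := by positivity
  rw [continuous_iff_continuousAt]
  rintro ⟨t, x⟩
  induction x using OnePoint.rec with
  | infty =>
    rw [ContinuousAt, nhds_prod_eq, OnePoint.nhds_infty_eq, Filter.prod_sup, Filter.tendsto_sup]
    constructor
    · rw [← Filter.map_id (f := nhds t), Filter.prod_map_map_eq, Filter.tendsto_map'_iff]
      have h1 : Filter.Tendsto (fun p : X × E3 => h p.1 p.2)
          (nhds t ×ˢ Filter.coclosedCompact E3) (Filter.coclosedCompact E3) := by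
        rw [Filter.coclosedCompact_eq_cocompact, ← Metric.cobounded_eq_cocompact,
          ← tendsto_norm_atTop_iff_cobounded]
        have h2 : Filter.Tendsto (fun p : X × E3 => ‖p.2‖ / (|C| + 1))
            (nhds t ×ˢ Bornology.cobounded E3) Filter.atTop :=
          (tendsto_norm_cobounded_atTop.comp Filter.tendsto_snd).atTop_div_const hpos
        refine Filter.tendsto_atTop_mono (fun p => ?_) h2
        rw [div_le_iff₀ hpos, mul_comm]
        exact hC' p.1 p.2
      exact (OnePoint.tendsto_coe_infty.comp h1 :)
    · refine Filter.Tendsto.mono_left ?_ (Filter.prod_mono_right _ (le_refl _))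
      rw [Filter.prod_pure, Filter.tendsto_map'_iff]
      exact tendsto_const_nhds
  | coe x =>
    rw [ContinuousAt, nhds_prod_eq, OnePoint.nhds_coe_eq, ← Filter.map_id (f := nhds t),
      Filter.prod_map_map_eq, Filter.tendsto_map'_iff, ← nhds_prod_eq]
    exact ((OnePoint.continuous_coe.comp hc).tendsto (t, x) :)

/-- Linear interpolation between two self-maps of `ℝ³` gives a homotopy between their extensions
to the 3-sphere if it expands norms at least by a uniform positive factor. -/
theorem homotopic_of_segment {f₀ f₁ : E3 → E3} (h₀ : Continuous f₀) (h₁ : Continuous f₁) {C : ℝ}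
    (hC : ∀ t : ℝ, 0 ≤ t → t ≤ 1 → ∀ x, ‖x‖ ≤ C * ‖(1 - t) • f₀ x + t • f₁ x‖)
    {F₀ F₁ : C(S3, S3)} (hF₀ : ⇑F₀ = OnePoint.map f₀) (hF₁ : ⇑F₁ = OnePoint.map f₁) :
    F₀.Homotopic F₁ := by
  refine ⟨⟨⟨fun p => OnePoint.map
    (fun x => (1 - (p.1 : ℝ)) • f₀ x + (p.1 : ℝ) • f₁ x) p.2, ?_⟩, ?_, ?_⟩⟩
  · exact continuous_map_family (h := fun (s : unitInterval) x =>
      (1 - (s : ℝ)) • f₀ x + (s : ℝ) • f₁ x) (by fun_prop) (C := C)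
      (fun s x => hC s s.2.1 s.2.2 x)
  · intro x
    simp [hF₀]
  · intro x
    simp [hF₁]

theorem continuous_onePointMap {f : E3 → E3} (hf : Continuous f) {C : ℝ}
    (hC : ∀ x, ‖x‖ ≤ C * ‖f x‖) : Continuous (OnePoint.map f) :=
  (continuous_map_family (X := Unit) (h := fun _ => f) (by fun_prop) (fun _ => hC)).comp
    (continuous_const.prodMk continuous_id : Continuous fun x : S3 => ((), x))

/-! ### The norm whose unit sphere is the pillowcase -/

theorem E3.norm_sq (x : E3) : ‖x‖ ^ 2 = x 0 ^ 2 + x 1 ^ 2 + x 2 ^ 2 := by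
  rw [EuclideanSpace.norm_sq_eq, Fin.sum_univ_three]
  simp only [Real.norm_eq_abs, sq_abs]

/-- The norm on `ℝ³` whose unit sphere is the pillowcase. -/
def gauge (x : E3) : ℝ := (√((x 0 + x 1) ^ 2 + x 2 ^ 2) + √((x 0 - x 1) ^ 2 + x 2 ^ 2)) / 2

theorem continuous_gauge : Continuous gauge := by
  unfold gauge
  fun_prop

theorem gauge_nonneg (x : E3) : 0 ≤ gauge x := by
  unfold gauge
  positivity

theorem gauge_smul {t : ℝ} (ht : 0 ≤ t) (x : E3) : gauge (t • x) = t * gauge x := by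
  have h : ∀ a b : ℝ, √((t * a) ^ 2 + (t * b) ^ 2) = t * √(a ^ 2 + b ^ 2) := fun a b => by
    rw [mul_pow, mul_pow, ← mul_add, Real.sqrt_mul (sq_nonneg t), Real.sqrt_sq ht]
  simp only [gauge, PiLp.smul_apply, smul_eq_mul, ← mul_add, ← mul_sub, h]
  ring

theorem norm_sq_le (x : E3) : ‖x‖ ^ 2 ≤ 2 * gauge x ^ 2 := by
  have h1 := Real.sq_sqrt (show 0 ≤ (x 0 + x 1) ^ 2 + x 2 ^ 2 by positivity)
  have h2 := Real.sq_sqrt (show 0 ≤ (x 0 - x 1) ^ 2 + x 2 ^ 2 by positivity)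
  have h3 := Real.sqrt_nonneg ((x 0 + x 1) ^ 2 + x 2 ^ 2)
  have h4 := Real.sqrt_nonneg ((x 0 - x 1) ^ 2 + x 2 ^ 2)
  rw [E3.norm_sq, gauge]
  nlinarith [mul_nonneg h3 h4]

theorem gauge_sq_le (x : E3) : gauge x ^ 2 ≤ ‖x‖ ^ 2 := by
  have h1 := Real.sq_sqrt (show 0 ≤ (x 0 + x 1) ^ 2 + x 2 ^ 2 by positivity)
  have h2 := Real.sq_sqrt (show 0 ≤ (x 0 - x 1) ^ 2 + x 2 ^ 2 by positivity)
  rw [E3.norm_sq, gauge]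
  nlinarith [sq_nonneg (√((x 0 + x 1) ^ 2 + x 2 ^ 2) - √((x 0 - x 1) ^ 2 + x 2 ^ 2))]

theorem gauge_le_norm (x : E3) : gauge x ≤ ‖x‖ :=
  (sq_le_sq₀ (gauge_nonneg x) (norm_nonneg x)).mp (gauge_sq_le x)

theorem gauge_zero : gauge 0 = 0 := by simp [gauge]

theorem gauge_pos {x : E3} (hx : x ≠ 0) : 0 < gauge x := by
  have h := norm_pos_iff.mpr hx
  have h1 := norm_sq_le x
  refine lt_of_le_of_ne (gauge_nonneg x) fun h0 => ?_
  rw [← h0] at h1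
  nlinarith

theorem abs_apply_zero_le (x : E3) : |x 0| ≤ gauge x := by
  have h1 : |x 0 + x 1| ≤ √((x 0 + x 1) ^ 2 + x 2 ^ 2) :=
    Real.abs_le_sqrt (by nlinarith [sq_nonneg (x 2)])
  have h2 : |x 0 - x 1| ≤ √((x 0 - x 1) ^ 2 + x 2 ^ 2) :=
    Real.abs_le_sqrt (by nlinarith [sq_nonneg (x 2)])
  rw [gauge]
  rw [abs_le] at *
  constructor <;> linarith

theorem abs_apply_one_le (x : E3) : |x 1| ≤ gauge x := by
  have h1 : |x 0 + x 1| ≤ √((x 0 + x 1) ^ 2 + x 2 ^ 2) :=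
    Real.abs_le_sqrt (by nlinarith [sq_nonneg (x 2)])
  have h2 : |x 0 - x 1| ≤ √((x 0 - x 1) ^ 2 + x 2 ^ 2) :=
    Real.abs_le_sqrt (by nlinarith [sq_nonneg (x 2)])
  rw [gauge]
  rw [abs_le] at *
  constructor <;> linarith

/-- The defining quartic equation of the pillowcase, homogenized. -/
theorem gauge_quartic (x : E3) :
    gauge x ^ 4 - ‖x‖ ^ 2 * gauge x ^ 2 + x 0 ^ 2 * x 1 ^ 2 = 0 := by
  have h1 := Real.sq_sqrt (show 0 ≤ (x 0 + x 1) ^ 2 + x 2 ^ 2 by positivity)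
  have h2 := Real.sq_sqrt (show 0 ≤ (x 0 - x 1) ^ 2 + x 2 ^ 2 by positivity)
  rw [E3.norm_sq, gauge]
  set s := √((x 0 + x 1) ^ 2 + x 2 ^ 2)
  set t := √((x 0 - x 1) ^ 2 + x 2 ^ 2)
  have h3 : x 0 ^ 2 + x 1 ^ 2 + x 2 ^ 2 = (s ^ 2 + t ^ 2) / 2 := by rw [h1, h2]; ring
  have h4 : x 0 ^ 2 * x 1 ^ 2 = ((s ^ 2 - t ^ 2) / 4) ^ 2 := by rw [h1, h2]; ring
  rw [h3, h4]
  ring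

theorem gauge_pillowE (w : ℝ × ℝ) : gauge (pillowE w) = 1 := by
  have h1 := Real.sin_sq_add_cos_sq (Real.pi * w.1)
  have h2 := Real.sin_sq_add_cos_sq (Real.pi * w.2)
  have b1 := Real.abs_cos_le_one (Real.pi * w.1)
  have b2 := Real.abs_cos_le_one (Real.pi * w.2)
  have e1 : (pillowE w 0 + pillowE w 1) ^ 2 + pillowE w 2 ^ 2 =
      (1 + Real.cos (Real.pi * w.1) * Real.cos (Real.pi * w.2)) ^ 2 := by
    simp only [pillowE, PiLp.toLp_apply, Matrix.cons_val_zero, Matrix.cons_val_one,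
      Matrix.cons_val]
    rw [mul_pow, eq_sub_of_add_eq h1, eq_sub_of_add_eq h2]
    ring
  have e2 : (pillowE w 0 - pillowE w 1) ^ 2 + pillowE w 2 ^ 2 =
      (1 - Real.cos (Real.pi * w.1) * Real.cos (Real.pi * w.2)) ^ 2 := by
    simp only [pillowE, PiLp.toLp_apply, Matrix.cons_val_zero, Matrix.cons_val_one,
      Matrix.cons_val]
    rw [mul_pow, eq_sub_of_add_eq h1, eq_sub_of_add_eq h2]
    ring
  have b3 : |Real.cos (Real.pi * w.1) * Real.cos (Real.pi * w.2)| ≤ 1 := by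
    rw [abs_mul]
    exact mul_le_one₀ b1 (abs_nonneg _) b2
  rw [abs_le] at b3
  rw [gauge, e1, e2, Real.sqrt_sq (by linarith), Real.sqrt_sq (by linarith)]
  ring

theorem exists_pillowE_eq {x : E3} (hx : gauge x = 1) : ∃ w, pillowE w = x := by
  have b0 := abs_apply_zero_le x
  have b1 := abs_apply_one_le x
  have hq := gauge_quartic x
  rw [hx, abs_le] at b0 b1
  rw [hx, E3.norm_sq] at hq
  have hz : x 2 ^ 2 = (1 - x 0 ^ 2) * (1 - x 1 ^ 2) := by linarith
  have c0 : Real.cos (Real.pi * (Real.arccos (-x 0) / Real.pi)) = -x 0 := by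
    rw [mul_div_cancel₀ _ Real.pi_ne_zero, Real.cos_arccos (by linarith) (by linarith)]
  have c1 : Real.cos (Real.pi * (Real.arccos (-x 1) / Real.pi)) = -x 1 := by
    rw [mul_div_cancel₀ _ Real.pi_ne_zero, Real.cos_arccos (by linarith) (by linarith)]
  have s0 : Real.sin (Real.pi * (Real.arccos (-x 0) / Real.pi)) = √(1 - x 0 ^ 2) := by
    rw [mul_div_cancel₀ _ Real.pi_ne_zero, Real.sin_arccos, neg_sq]
  have s1 : Real.sin (Real.pi * (Real.arccos (-x 1) / Real.pi)) = √(1 - x 1 ^ 2) := by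
    rw [mul_div_cancel₀ _ Real.pi_ne_zero, Real.sin_arccos, neg_sq]
  have hs : √(1 - x 0 ^ 2) * √(1 - x 1 ^ 2) = |x 2| := by
    rw [← Real.sqrt_mul (by nlinarith), ← hz, Real.sqrt_sq_eq_abs]
  rcases le_total 0 (x 2) with h | h
  · refine ⟨(Real.arccos (-x 0) / Real.pi, Real.arccos (-x 1) / Real.pi), ?_⟩
    ext i
    fin_cases i <;> simp [pillowE, c0, c1, s0, s1, hs, abs_of_nonneg h]
  · refine ⟨(-(Real.arccos (-x 0) / Real.pi), Real.arccos (-x 1) / Real.pi), ?_⟩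
    ext i
    fin_cases i <;> simp [pillowE, c0, c1, s0, s1, hs, abs_of_nonpos h]

theorem exists_eq_smul_pillowE {x : E3} (hx : x ≠ 0) : ∃ w, x = gauge x • pillowE w := by
  have h := gauge_pos hx
  obtain ⟨w, hw⟩ := exists_pillowE_eq (x := (gauge x)⁻¹ • x)
    (by rw [gauge_smul (inv_nonneg.mpr h.le), inv_mul_cancel₀ h.ne'])
  exact ⟨w, by rw [hw, smul_inv_smul₀ h.ne']⟩

/-! ### Extending self-maps of the pillowcase to the 3-sphere -/

/-- On the ray through a point `p` of the pillowcase, the inversion maps `p` to `ratio p • p`.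
The definition is extended to be constant on rays. -/
def ratio (x : E3) : ℝ := 2 * gauge x ^ 2 / ‖x‖ ^ 2

theorem one_le_ratio {x : E3} (hx : x ≠ 0) : 1 ≤ ratio x := by
  have : 0 < ‖x‖ := norm_pos_iff.mpr hx
  rw [ratio, one_le_div (by positivity)]
  exact norm_sq_le x

theorem ratio_le_two (x : E3) : ratio x ≤ 2 := by
  refine div_le_of_le_mul₀ (by positivity) (by norm_num) ?_
  linarith [gauge_sq_le x]

theorem ratio_smul {t : ℝ} (ht : 0 < t) (x : E3) : ratio (t • x) = ratio x := by
  have : t ≠ 0 := ht.ne'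
  rw [ratio, ratio, gauge_smul ht.le, norm_smul, Real.norm_of_nonneg ht.le, mul_pow, mul_pow,
    mul_left_comm, mul_div_mul_left _ _ (by positivity)]

/-- The self-homeomorphism of `[0, ∞)` that is the identity on `[0, 1]`, affine on `[1, c]`, and
linear on `[c, ∞)`, and maps `c` to `c'`. If `c = c' = 1`, it is the identity. -/
def radial (c c' l : ℝ) : ℝ :=
  min l 1 + (c' - 1) * max 0 (min 1 ((l - 1) / (c - 1))) + max 0 (l - c) * (c' / c)

theorem radial_of_le_one {c c' l : ℝ} (hc : 1 ≤ c) (hl : l ≤ 1) : radial c c' l = l := by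
  have h1 : (l - 1) / (c - 1) ≤ 0 := div_nonpos_of_nonpos_of_nonneg (by linarith) (by linarith)
  rw [radial, min_eq_left hl, max_eq_left ((min_le_right _ _).trans h1),
    max_eq_left (by linarith)]
  ring

theorem radial_of_mem {c c' l : ℝ} (hl : 1 < l) (hlc : l ≤ c) :
    radial c c' l = 1 + (c' - 1) * ((l - 1) / (c - 1)) := by
  have h1 : (l - 1) / (c - 1) ≤ 1 := (div_le_one (by linarith)).mpr (by linarith)
  have h0 : 0 ≤ (l - 1) / (c - 1) := div_nonneg (by linarith) (by linarith)
  rw [radial, min_eq_right hl.le, min_eq_right h1, max_eq_right h0, max_eq_left (by linarith)]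
  ring

theorem radial_of_lt {c c' l : ℝ} (hc : 1 ≤ c) (hcc' : c = 1 → c' = 1) (hl : c < l) :
    radial c c' l = l * (c' / c) := by
  rw [radial, min_eq_right (by linarith), max_eq_right (a := 0) (b := l - c) (by linarith)]
  rcases hc.eq_or_lt with rfl | hc
  · rw [hcc' rfl]
    ring
  · have h1 : 1 ≤ (l - 1) / (c - 1) := (one_le_div (by linarith)).mpr (by linarith)
    rw [min_eq_left h1, max_eq_right zero_le_one]
    field_simp
    ring

theorem radial_self {c c' : ℝ} (hc : 1 ≤ c) (hcc' : c = 1 → c' = 1) : radial c c' c = c' := by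
  rcases hc.eq_or_lt with rfl | h
  · rw [radial_of_le_one le_rfl le_rfl, hcc' rfl]
  · rw [radial_of_mem h le_rfl, div_self (by linarith)]
    ring

theorem radial_radial {c c' : ℝ} (hc : 1 ≤ c) (hc' : 1 ≤ c') (h : c = 1 ↔ c' = 1) (l : ℝ) :
    radial c' c (radial c c' l) = l := by
  rcases le_or_gt l 1 with hl | hl
  · rw [radial_of_le_one hc hl, radial_of_le_one hc' hl]
  rcases le_or_gt l c with hlc | hlc
  · have h1 : 1 < c := hl.trans_le hlc
    have h1' : 1 < c' := lt_of_le_of_ne hc' fun e => h1.ne' (h.mpr e.symm)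
    have h2 : 0 < (l - 1) / (c - 1) := div_pos (by linarith) (by linarith)
    have h3 : (l - 1) / (c - 1) ≤ 1 := (div_le_one (by linarith)).mpr (by linarith)
    rw [radial_of_mem hl hlc, radial_of_mem (by nlinarith) (by nlinarith)]
    have h4 : c - 1 ≠ 0 := by linarith
    have h5 : c' - 1 ≠ 0 := by linarith
    field_simp
    ring
  · have h1 : c' < l * (c' / c) := by
      rw [mul_div_assoc', lt_div_iff₀ (by linarith)]
      nlinarith
    rw [radial_of_lt hc h.mp hlc, radial_of_lt hc' h.mpr h1]
    field_simp

/-- A uniform lower bound that holds since the ratios lie in `[1, 2]`. -/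
theorem half_le_radial {c c' l : ℝ} (hc : 1 ≤ c) (hc' : 1 ≤ c') (h : c = 1 → c' = 1)
    (hc2 : c ≤ 2) (hl : 0 ≤ l) : l / 2 ≤ radial c c' l := by
  rcases le_or_gt l 1 with hl1 | hl1
  · rw [radial_of_le_one hc hl1]
    linarith
  rcases le_or_gt l c with hlc | hlc
  · rw [radial_of_mem hl1 hlc]
    have h2 : 0 ≤ (c' - 1) * ((l - 1) / (c - 1)) :=
      mul_nonneg (by linarith) (div_nonneg (by linarith) (by linarith))
    linarith
  · rw [radial_of_lt hc h hlc, div_eq_mul_one_div]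
    refine mul_le_mul_of_nonneg_left ?_ hl
    rw [div_le_div_iff₀ (by norm_num) (by linarith)]
    linarith

theorem continuousAt_radial {q : ℝ × ℝ × ℝ} (hq : 1 ≤ q.1) (h : q.1 = 1 → q.2.1 = 1) :
    ContinuousAt (fun p : ℝ × ℝ × ℝ => radial p.1 p.2.1 p.2.2) q := by
  have h0 : q.1 ≠ 0 := by linarith
  unfold radial
  refine ContinuousAt.add (ContinuousAt.add (by fun_prop) ?_) ?_
  · by_cases h1 : q.1 = 1
    · -- The quotient has no limit here, but it is clamped to `[0, 1]`, and its factor tends to `0`.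
      have h2 : Filter.Tendsto (fun p : ℝ × ℝ × ℝ => |p.2.1 - 1|) (nhds q) (nhds 0) := by
        have : ContinuousAt (fun p : ℝ × ℝ × ℝ => |p.2.1 - 1|) q := by fun_prop
        simpa [ContinuousAt, h h1] using this
      rw [ContinuousAt, h h1, sub_self, zero_mul]
      refine squeeze_zero_norm (fun p => ?_) h2
      rw [Real.norm_eq_abs, abs_mul]
      refine mul_le_of_le_one_right (abs_nonneg _) ?_
      rw [abs_of_nonneg (le_max_left _ _)]
      exact max_le zero_le_one (min_le_left _ _)
    · have h1' : q.1 - 1 ≠ 0 := sub_ne_zero.mpr h1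
      fun_prop (disch := assumption)
  · fun_prop (disch := assumption)

/-- A continuous self-map of `ℝ³` that is homogeneous on rays, preserves the pillowcase (hence its
multiples), and maps the points of the pillowcase on the boundary sphere to such points. -/
structure IsPillowMap (f : E3 → E3) : Prop where
  continuous : Continuous f
  map_smul : ∀ (t : ℝ) (x : E3), 0 ≤ t → f (t • x) = t • f x
  gauge_map : ∀ x, gauge (f x) = gauge x
  corner : ∀ x, ratio x = 1 → ratio (f x) = 1

theorem IsPillowMap.map_zero {f : E3 → E3} (hf : IsPillowMap f) : f 0 = 0 := by
  simpa using hf.map_smul 0 0 le_rfl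

theorem IsPillowMap.map_ne_zero {f : E3 → E3} (hf : IsPillowMap f) {x : E3} (hx : x ≠ 0) :
    f x ≠ 0 := by
  intro h
  have := hf.gauge_map x
  rw [h, gauge_zero] at this
  exact (gauge_pos hx).ne this

/-- The factor by which `f` is corrected in `spread f`. -/
def spreadFactor (f : E3 → E3) (x : E3) : ℝ := radial (ratio x) (ratio (f x)) (gauge x) / gauge x

/-- The self-map of `ℝ³` that agrees with `f` inside the pillowcase, and with the conjugate of `f`
by the inversion in the boundary of the ball outside the inverted pillowcase. -/
def spread (f : E3 → E3) (x : E3) : E3 := spreadFactor f x • f x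

theorem spread_zero {f : E3 → E3} (hf : IsPillowMap f) : spread f 0 = 0 := by
  rw [spread, hf.map_zero, smul_zero]

theorem half_le_spreadFactor {f : E3 → E3} (hf : IsPillowMap f) {x : E3} (hx : x ≠ 0) :
    1 / 2 ≤ spreadFactor f x := by
  rw [spreadFactor, le_div_iff₀ (gauge_pos hx)]
  have := half_le_radial (one_le_ratio hx) (one_le_ratio (hf.map_ne_zero hx)) (hf.corner x)
    (ratio_le_two x) (gauge_nonneg x)
  linarith

theorem spread_of_gauge_le_one {f : E3 → E3} (hf : IsPillowMap f) {x : E3} (hx : gauge x ≤ 1) :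
    spread f x = f x := by
  rcases eq_or_ne x 0 with rfl | h0
  · rw [spread_zero hf, hf.map_zero]
  · rw [spread, spreadFactor, radial_of_le_one (one_le_ratio h0) hx, div_self (gauge_pos h0).ne',
      one_smul]

theorem spread_ratio_smul {f : E3 → E3} (hf : IsPillowMap f) {p : E3} (hp : gauge p = 1) :
    spread f (ratio p • p) = ratio (f p) • f p := by
  have h0 : p ≠ 0 := by
    rintro rfl
    simp [gauge_zero] at hp
  have h1 := one_le_ratio h0
  have hpos : 0 < ratio p := by linarith
  rw [spread, spreadFactor, ratio_smul hpos, hf.map_smul _ _ hpos.le, ratio_smul hpos,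
    gauge_smul hpos.le, hp, mul_one, radial_self h1 (hf.corner p), smul_smul,
    div_mul_cancel₀ _ hpos.ne']

theorem continuous_spread {f : E3 → E3} (hf : IsPillowMap f) : Continuous (spread f) := by
  rw [continuous_iff_continuousAt]
  intro x
  rcases eq_or_ne x 0 with rfl | h0
  · refine hf.continuous.continuousAt.congr ?_
    have : ∀ᶠ y in nhds (0 : E3), gauge y < 1 :=
      continuous_gauge.continuousAt.eventually_lt continuousAt_const (by simp [gauge_zero])
    filter_upwards [this] with y hy
    exact (spread_of_gauge_le_one hf hy.le).symm
  · have hr : ∀ y : E3, y ≠ 0 → ContinuousAt ratio y := fun y hy => by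
      have : ‖y‖ ^ 2 ≠ 0 := pow_ne_zero 2 (norm_ne_zero_iff.mpr hy)
      have := continuous_gauge
      unfold ratio
      fun_prop (disch := assumption)
    refine ContinuousAt.smul (ContinuousAt.div ?_ continuous_gauge.continuousAt (gauge_pos h0).ne')
      hf.continuous.continuousAt
    exact ContinuousAt.comp (f := fun y => (ratio y, ratio (f y), gauge y))
      (g := fun p : ℝ × ℝ × ℝ => radial p.1 p.2.1 p.2.2)
      (continuousAt_radial (one_le_ratio h0) (hf.corner x))
      ((hr x h0).prodMk (((hr _ (hf.map_ne_zero h0)).comp hf.continuous.continuousAt).prodMk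
        continuous_gauge.continuousAt))

theorem spread_spread {f f' : E3 → E3} (hf : IsPillowMap f) (hf' : IsPillowMap f')
    (h : ∀ x, f' (f x) = x) (x : E3) : spread f' (spread f x) = x := by
  rcases eq_or_ne x 0 with rfl | h0
  · rw [spread_zero hf, spread_zero hf']
  · have hk : 0 < spreadFactor f x := by linarith [half_le_spreadFactor hf h0]
    have hg := gauge_pos h0
    have h1 : spreadFactor f x * gauge x = radial (ratio x) (ratio (f x)) (gauge x) := by
      rw [spreadFactor, div_mul_cancel₀ _ hg.ne']
    have h2 : spreadFactor f' (spread f x) = gauge x / (spreadFactor f x * gauge x) := by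
      rw [spread]
      nth_rewrite 1 [spreadFactor]
      rw [ratio_smul hk, hf'.map_smul _ _ hk.le, ratio_smul hk, h, gauge_smul hk.le, hf.gauge_map,
        h1, radial_radial (one_le_ratio h0) (one_le_ratio (hf.map_ne_zero h0))
          ⟨hf.corner x, fun e => by simpa [h] using hf'.corner _ e⟩]
    nth_rewrite 1 [spread]
    rw [h2, spread, hf'.map_smul _ _ hk.le, h, smul_smul]
    have h3 : gauge x / (spreadFactor f x * gauge x) * spreadFactor f x = 1 := by
      field_simp
    rw [h3, one_smul]

/-- The self-homeomorphism of the 3-sphere induced by an invertible self-map of the pillowcase. -/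
def spreadHomeo {f f' : E3 → E3} (hf : IsPillowMap f) (hf' : IsPillowMap f')
    (h : ∀ x, f' (f x) = x) (h' : ∀ x, f (f' x) = x) : S3 ≃ₜ S3 :=
  Homeomorph.onePointCongr
    { toFun := spread f
      invFun := spread f'
      left_inv := spread_spread hf hf' h
      right_inv := spread_spread hf' hf h'
      continuous_toFun := continuous_spread hf
      continuous_invFun := continuous_spread hf' }

theorem norm_le_gauge (x : E3) : ‖x‖ ≤ 2 * gauge x := by
  have := norm_sq_le x
  have := gauge_nonneg x
  have := norm_nonneg x
  nlinarith

/-- The radial correction in `spread f` can be undone by a homotopy. -/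
theorem spreadHomeo_homotopic {f f' : E3 → E3} (hf : IsPillowMap f) (hf' : IsPillowMap f')
    (h : ∀ x, f' (f x) = x) (h' : ∀ x, f (f' x) = x) {F : C(S3, S3)} (hF : ⇑F = OnePoint.map f) :
    (spreadHomeo hf hf' h h' : C(S3, S3)).Homotopic F := by
  refine homotopic_of_segment (continuous_spread hf) hf.continuous (C := 4) ?_ rfl hF
  intro t ht0 ht1 x
  rcases eq_or_ne x 0 with rfl | h0
  · simp
  · have hk := half_le_spreadFactor hf h0
    rw [spread, smul_smul, ← add_smul]
    have h2 : 1 / 2 ≤ (1 - t) * spreadFactor f x + t := by nlinarith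
    have h3 : gauge x / 2 ≤ gauge (((1 - t) * spreadFactor f x + t) • f x) := by
      rw [gauge_smul (by linarith), hf.gauge_map]
      nlinarith [gauge_nonneg x]
    linarith [norm_le_gauge x, gauge_le_norm (((1 - t) * spreadFactor f x + t) • f x)]

/-! ### A Dehn half-twist of the pillowcase -/

/-- The extension to `ℝ³`, homogeneous on rays, of the self-map `(u, v) ↦ (u + v, v)` of the
pillowcase. On the pillowcase, where `gauge x = 1`, it is polynomial: the section at the height
`x 1 = -cos (π v)` is an ellipse with half-axes `1` and `|sin (π v)|`, and adding `v` to `u` moves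
its points as the matrix `!![cos (π v), 1; -sin² (π v), cos (π v)]` does. -/
def shear (x : E3) : E3 :=
  !₂[x 2 - x 1 / gauge x * x 0, x 1,
    -(x 1 / gauge x * x 2) - (1 - (x 1 / gauge x) ^ 2) * x 0]

/-- The reflection that induces `(u, v) ↦ (-u, v)` on the pillowcase. -/
def flip (x : E3) : E3 := !₂[x 0, x 1, -x 2]

/-- The reflection that induces `(u, v) ↦ (v, u)` on the pillowcase. -/
def swap (x : E3) : E3 := !₂[x 1, x 0, x 2]

theorem shear_pillowE (w : ℝ × ℝ) : shear (pillowE w) = pillowE (w.1 + w.2, w.2) := by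
  have h2 := Real.sin_sq_add_cos_sq (Real.pi * w.2)
  rw [shear, gauge_pillowE]
  ext i
  fin_cases i
  · simp [pillowE, mul_add, Real.cos_add]
    ring
  · simp [pillowE]
  · simp [pillowE, mul_add, Real.sin_add]
    rw [← eq_sub_of_add_eq h2]
    ring

theorem flip_pillowE (w : ℝ × ℝ) : flip (pillowE w) = pillowE (-w.1, w.2) := by
  ext i
  fin_cases i <;> simp [pillowE, flip]

theorem swap_pillowE (w : ℝ × ℝ) : swap (pillowE w) = pillowE w.swap := by
  ext i
  fin_cases i <;> simp [pillowE, swap, mul_comm]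

theorem IsPillowMap.comp {f f' : E3 → E3} (hf : IsPillowMap f) (hf' : IsPillowMap f') :
    IsPillowMap (f ∘ f') where
  continuous := hf.continuous.comp hf'.continuous
  map_smul t x ht := by simp [hf'.map_smul t x ht, hf.map_smul t _ ht]
  gauge_map x := by simp [hf.gauge_map, hf'.gauge_map]
  corner x hx := hf.corner _ (hf'.corner x hx)

theorem isPillowMap_of_norm {f : E3 → E3} (hc : Continuous f)
    (hs : ∀ (t : ℝ) (x : E3), 0 ≤ t → f (t • x) = t • f x) (hg : ∀ x, gauge (f x) = gauge x)
    (hn : ∀ x, ‖f x‖ ^ 2 = ‖x‖ ^ 2) : IsPillowMap f where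
  continuous := hc
  map_smul := hs
  gauge_map := hg
  corner x hx := by rwa [ratio, hg, hn]

theorem isPillowMap_flip : IsPillowMap flip := by
  refine isPillowMap_of_norm (by unfold flip; fun_prop) (fun t x _ => ?_) (fun x => ?_)
    fun x => ?_
  · ext i
    fin_cases i <;> simp [flip]
  · simp [gauge, flip]
  · simp [E3.norm_sq, flip]

theorem isPillowMap_swap : IsPillowMap swap := by
  refine isPillowMap_of_norm (by unfold swap; fun_prop) (fun t x _ => ?_) (fun x => ?_)
    fun x => ?_
  · ext i
    fin_cases i <;> simp [swap]
  · simp only [gauge, swap, PiLp.toLp_apply, Matrix.cons_val_zero, Matrix.cons_val_one,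
      Matrix.cons_val]
    rw [add_comm (x 1), ← neg_sub (x 0), neg_sq]
  · simp only [E3.norm_sq, swap, Matrix.cons_val_zero, Matrix.cons_val_one, Matrix.cons_val]
    ring

theorem flip_flip (x : E3) : flip (flip x) = x := by
  ext i
  fin_cases i <;> simp [flip]

theorem swap_swap (x : E3) : swap (swap x) = x := by
  ext i
  fin_cases i <;> simp [swap]

theorem abs_apply_one_div_gauge_le (x : E3) : |x 1 / gauge x| ≤ 1 := by
  rw [abs_div, abs_of_nonneg (gauge_nonneg x)]
  exact div_le_one_of_le₀ (abs_apply_one_le x) (gauge_nonneg x)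

theorem continuous_bounded_mul_apply {b : E3 → ℝ} (hb : ∀ x, |b x| ≤ 1)
    (hc : ∀ x, x ≠ 0 → ContinuousAt b x) (i : Fin 3) : Continuous fun x : E3 => b x * x i := by
  rw [continuous_iff_continuousAt]
  intro x
  rcases eq_or_ne x 0 with rfl | h0
  · have h : Filter.Tendsto (fun x : E3 => |x i|) (nhds 0) (nhds 0) := by
      have : ContinuousAt (fun x : E3 => |x i|) 0 := by fun_prop
      simpa [ContinuousAt] using this
    rw [ContinuousAt, PiLp.zero_apply, mul_zero]
    refine squeeze_zero_norm (fun y => ?_) h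
    rw [Real.norm_eq_abs, abs_mul]
    exact mul_le_of_le_one_left (abs_nonneg _) (hb y)
  · exact (hc x h0).mul (by fun_prop)

theorem continuous_shear : Continuous shear := by
  have h1 : ∀ x : E3, x ≠ 0 → ContinuousAt (fun x : E3 => x 1 / gauge x) x := fun x hx => by
    have := (gauge_pos hx).ne'
    have := continuous_gauge
    fun_prop (disch := assumption)
  have h2 := continuous_bounded_mul_apply abs_apply_one_div_gauge_le h1
  have h3 := continuous_bounded_mul_apply (b := fun x : E3 => 1 - (x 1 / gauge x) ^ 2)
    (fun x => by
      have := (sq_le_one_iff_abs_le_one _).mpr (abs_apply_one_div_gauge_le x)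
      rw [abs_le]
      constructor <;> nlinarith [sq_nonneg (x 1 / gauge x)])
    (fun x hx => continuousAt_const.sub ((h1 x hx).pow 2)) 0
  have h4 := h2 0
  have h5 := h2 2
  unfold shear
  fun_prop

theorem shear_smul {t : ℝ} (ht : 0 ≤ t) (x : E3) : shear (t • x) = t • shear x := by
  rcases ht.eq_or_lt with rfl | ht
  · ext i
    fin_cases i <;> simp [shear]
  · have h : t * x 1 / (t * gauge x) = x 1 / gauge x := mul_div_mul_left _ _ ht.ne'
    ext i
    fin_cases i
    · simp [shear, gauge_smul ht.le, h]
      ring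
    · simp [shear]
    · simp [shear, gauge_smul ht.le, h]
      ring

theorem ratio_pillowE (w : ℝ × ℝ) : ratio (pillowE w) =
    2 / (1 + Real.cos (Real.pi * w.1) ^ 2 * Real.cos (Real.pi * w.2) ^ 2) := by
  rw [ratio, gauge_pillowE, norm_sq_pillowE, one_pow, mul_one]

theorem isPillowMap_shear : IsPillowMap shear where
  continuous := continuous_shear
  map_smul _ x ht := shear_smul ht x
  gauge_map x := by
    rcases eq_or_ne x 0 with rfl | h0
    · simpa using congrArg gauge (shear_smul le_rfl 0)
    · obtain ⟨w, hw⟩ := exists_eq_smul_pillowE h0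
      rw [hw, shear_smul (gauge_nonneg x), shear_pillowE, gauge_smul (gauge_nonneg x),
        gauge_smul (gauge_nonneg x), gauge_pillowE, gauge_pillowE]
  corner x hx := by
    rcases eq_or_ne x 0 with rfl | h0
    · simp [ratio, gauge_zero] at hx
    · obtain ⟨w, hw⟩ := exists_eq_smul_pillowE h0
      have hg := gauge_pos h0
      rw [hw, ratio_smul hg, ratio_pillowE, div_eq_one_iff_eq (by positivity)] at hx
      rw [hw, shear_smul hg.le, ratio_smul hg, shear_pillowE, ratio_pillowE,
        div_eq_one_iff_eq (by positivity)]
      have h1 := Real.sin_sq_add_cos_sq (Real.pi * w.1)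
      have h2 := Real.sin_sq_add_cos_sq (Real.pi * w.2)
      have h3 := Real.cos_sq_le_one (Real.pi * w.1)
      have h4 := Real.cos_sq_le_one (Real.pi * w.2)
      have h5 : Real.cos (Real.pi * w.1) ^ 2 = 1 := by
        nlinarith [sq_nonneg (Real.cos (Real.pi * w.1))]
      have h6 : Real.cos (Real.pi * w.2) ^ 2 = 1 := by
        nlinarith [sq_nonneg (Real.cos (Real.pi * w.2))]
      have h7 : Real.sin (Real.pi * w.1) = 0 := by
        rw [← sq_eq_zero_iff]
        linarith
      have h8 : Real.cos (Real.pi * (w.1 + w.2)) ^ 2 = 1 := by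
        rw [mul_add, Real.cos_add, h7, zero_mul, sub_zero, mul_pow, h5, h6, one_mul]
      rw [h8, h6]
      norm_num

/-- The inverse of `shear`. -/
def unshear : E3 → E3 := flip ∘ shear ∘ flip

theorem isPillowMap_unshear : IsPillowMap unshear :=
  isPillowMap_flip.comp (isPillowMap_shear.comp isPillowMap_flip)

theorem unshear_shear (x : E3) : unshear (shear x) = x := by
  rcases eq_or_ne x 0 with rfl | h0
  · rw [isPillowMap_shear.map_zero, isPillowMap_unshear.map_zero]
  · obtain ⟨w, hw⟩ := exists_eq_smul_pillowE h0
    have hg := gauge_nonneg x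
    rw [hw, isPillowMap_shear.map_smul _ _ hg, isPillowMap_unshear.map_smul _ _ hg]
    simp [unshear, shear_pillowE, flip_pillowE]

theorem shear_unshear (x : E3) : shear (unshear x) = x := by
  have h := unshear_shear (flip x)
  simp only [unshear, Function.comp_apply] at *
  rw [← flip_flip (shear _), h, flip_flip]

/-- The quarter turn about the second axis. -/
def quarterTurn (x : E3) : E3 := !₂[x 2, x 1, -x 0]

/-- If two points of `ℝ³` have the same second coordinate, and their other coordinates are related
by the matrix `!![a, b; d, a]` with entries in `[-1, 1]` and determinant at least `1 / 2`, their norms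
are comparable. -/
theorem norm_le_of_matrix {x y : E3} {a b d : ℝ} (ha : a ^ 2 ≤ 1) (hb : b ^ 2 ≤ 1)
    (hd : d ^ 2 ≤ 1) (hdet : 1 / 2 ≤ a ^ 2 - b * d) (h0 : y 0 = a * x 0 + b * x 2)
    (h1 : y 1 = x 1) (h2 : y 2 = d * x 0 + a * x 2) : ‖x‖ ≤ 4 * ‖y‖ := by
  refine (sq_le_sq₀ (norm_nonneg _) (by positivity)).mp ?_
  rw [mul_pow, E3.norm_sq, E3.norm_sq, h1]
  have e0 : (a ^ 2 - b * d) * x 0 = a * y 0 - b * y 2 := by rw [h0, h2]; ring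
  have e2 : (a ^ 2 - b * d) * x 2 = a * y 2 - d * y 0 := by rw [h0, h2]; ring
  have k : ∀ p q s t : ℝ, p ^ 2 ≤ 1 → q ^ 2 ≤ 1 → (p * s - q * t) ^ 2 ≤ 2 * (s ^ 2 + t ^ 2) := by
    intro p q s t hp hq
    nlinarith [sq_nonneg (p * s + q * t), mul_nonneg (sub_nonneg.mpr hp) (sq_nonneg s),
      mul_nonneg (sub_nonneg.mpr hq) (sq_nonneg t)]
  have k0 := k a b (y 0) (y 2) ha hb
  have k2 := k a d (y 2) (y 0) ha hd
  rw [← e0, mul_pow] at k0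
  rw [← e2, mul_pow] at k2
  have hδ : 1 / 4 ≤ (a ^ 2 - b * d) ^ 2 := by nlinarith
  have l0 := mul_le_mul_of_nonneg_right hδ (sq_nonneg (x 0))
  have l2 := mul_le_mul_of_nonneg_right hδ (sq_nonneg (x 2))
  nlinarith [sq_nonneg (x 1)]

/-- The half-twist is homotopic to the quarter turn, and this to the identity, in both cases by
linear interpolation. -/
theorem shear_homotopic_id : ∃ F : C(S3, S3), ⇑F = OnePoint.map shear ∧
    F.Homotopic (ContinuousMap.id S3) := by
  have hq : Continuous quarterTurn := by
    unfold quarterTurn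
    fun_prop
  have H1 : ∀ t : ℝ, 0 ≤ t → t ≤ 1 → ∀ x,
      ‖x‖ ≤ 4 * ‖(1 - t) • shear x + t • quarterTurn x‖ := by
    intro t h0 h1 x
    have hY := abs_apply_one_div_gauge_le x
    set Y := x 1 / gauge x with hYdef
    have hY2 : Y ^ 2 ≤ 1 := (sq_le_one_iff_abs_le_one _).mpr hY
    have hY0 := sq_nonneg Y
    refine norm_le_of_matrix (a := -((1 - t) * Y)) (b := 1)
      (d := -((1 - t) * (1 - Y ^ 2) + t)) ?_ (by norm_num) ?_ ?_ ?_ ?_ ?_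
    · rw [neg_sq, mul_pow]
      exact mul_le_one₀ (by nlinarith) hY0 hY2
    · rw [neg_sq]
      have : 0 ≤ (1 - t) * (1 - Y ^ 2) + t := by nlinarith
      have : (1 - t) * (1 - Y ^ 2) + t ≤ 1 := by nlinarith
      nlinarith
    · -- The determinant is `1 - t * (1 - t) * Y ^ 2`.
      nlinarith [mul_nonneg (mul_nonneg h0 (sub_nonneg.mpr h1)) (sub_nonneg.mpr hY2),
        sq_nonneg (1 - 2 * t)]
    · simp [shear, quarterTurn, ← hYdef]
      ring
    · simp [shear, quarterTurn]
      ring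
    · simp [shear, quarterTurn, ← hYdef]
      ring
  have H2 : ∀ t : ℝ, 0 ≤ t → t ≤ 1 → ∀ x, ‖x‖ ≤ 4 * ‖(1 - t) • quarterTurn x + t • x‖ := by
    intro t h0 h1 x
    refine norm_le_of_matrix (a := t) (b := 1 - t) (d := -(1 - t)) (by nlinarith) (by nlinarith)
      (by nlinarith) (by nlinarith [sq_nonneg (1 - 2 * t)]) ?_ ?_ ?_
    · simp [quarterTurn]
      ring
    · simp [quarterTurn]
      ring
    · simp [quarterTurn]
      ring
  let F : C(S3, S3) := ⟨OnePoint.map shear,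
    continuous_onePointMap continuous_shear fun x => by simpa using H1 0 le_rfl zero_le_one x⟩
  let G : C(S3, S3) := ⟨OnePoint.map quarterTurn,
    continuous_onePointMap hq fun x => by simpa using H2 0 le_rfl zero_le_one x⟩
  have hFG : F.Homotopic G := homotopic_of_segment continuous_shear hq H1 rfl rfl
  have hG : G.Homotopic (ContinuousMap.id S3) :=
    homotopic_of_segment hq continuous_id H2 rfl (by simp)
  exact ⟨F, rfl, hFG.trans hG⟩

/-- The self-homeomorphism of the 3-sphere induced by the half-twist of the pillowcase. -/
def shearHomeo : S3 ≃ₜ S3 :=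
  spreadHomeo isPillowMap_shear isPillowMap_unshear unshear_shear shear_unshear

theorem orientationPreserving_shearHomeo : OrientationPreserving shearHomeo := by
  obtain ⟨F, hF, h⟩ := shear_homotopic_id
  exact orientationPreserving_of_homotopic ((spreadHomeo_homotopic _ _ _ _ hF).trans h)

/-! ### The action of the modular group -/

theorem inv3_pillow (w : ℝ × ℝ) : inv3 (ballIncl (pillow w)) =
    ((ratio (pillowE w) • pillowE w : E3) : S3) := by
  have h0 : pillowE w ≠ 0 := by
    intro h
    simpa [h, gauge_zero] using gauge_pillowE w
  change (if pillowE w = 0 then ∞ else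
    ((EuclideanGeometry.inversion (0 : E3) √2 (pillowE w) : E3) : S3)) = _
  rw [if_neg h0, EuclideanGeometry.inversion, dist_zero_right, vsub_eq_sub, sub_zero,
    vadd_eq_add, add_zero, div_pow, Real.sq_sqrt zero_le_two, ratio, gauge_pillowE, one_pow,
    mul_one]

/-- The homeomorphism `Φ` of the 3-sphere induces the map `a` of the plane on the pillowcase and
on its image under the inversion. -/
def Realizes (Φ : S3 ≃ₜ S3) (a : ℝ × ℝ → ℝ × ℝ) : Prop :=
  ∀ w, Φ (ballIncl (pillow w)) = ballIncl (pillow (a w)) ∧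
    Φ (inv3 (ballIncl (pillow w))) = inv3 (ballIncl (pillow (a w)))

theorem Realizes.trans {Φ Ψ : S3 ≃ₜ S3} {a b : ℝ × ℝ → ℝ × ℝ} (hΦ : Realizes Φ a)
    (hΨ : Realizes Ψ b) : Realizes (Φ.trans Ψ) (b ∘ a) := fun w =>
  ⟨by simp [(hΦ w).1, (hΨ (a w)).1], by simp [(hΦ w).2, (hΨ (a w)).2]⟩

theorem Realizes.symm {Φ : S3 ≃ₜ S3} {a b : ℝ × ℝ → ℝ × ℝ} (hΦ : Realizes Φ a)
    (h : ∀ w, a (b w) = w) : Realizes Φ.symm b := fun w =>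
  ⟨by rw [Homeomorph.symm_apply_eq, (hΦ _).1, h], by rw [Homeomorph.symm_apply_eq, (hΦ _).2, h]⟩

theorem realizes_spreadHomeo {f f' : E3 → E3} (hf : IsPillowMap f) (hf' : IsPillowMap f')
    (h : ∀ x, f' (f x) = x) (h' : ∀ x, f (f' x) = x) {a : ℝ × ℝ → ℝ × ℝ}
    (ha : ∀ w, f (pillowE w) = pillowE (a w)) : Realizes (spreadHomeo hf hf' h h') a := by
  intro w
  constructor
  · change ((spread f (pillowE w) : E3) : S3) = ((pillowE (a w) : E3) : S3)
    rw [spread_of_gauge_le_one hf (gauge_pillowE w).le, ha]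
  · rw [inv3_pillow, inv3_pillow]
    change ((spread f (ratio (pillowE w) • pillowE w) : E3) : S3) = _
    rw [spread_ratio_smul hf (gauge_pillowE w), ha]

/-- The action of the modular group on the plane. The coordinates are interchanged, since a line
of slope `p / q` is spanned by `(u, v) = (q, p)`. -/
def act (A : SL(2, ℤ)) (w : ℝ × ℝ) : ℝ × ℝ :=
  (A 1 0 * w.2 + A 1 1 * w.1, A 0 0 * w.2 + A 0 1 * w.1)

theorem act_one (w : ℝ × ℝ) : act 1 w = w := by
  simp [act]

theorem act_mul (A B : SL(2, ℤ)) (w : ℝ × ℝ) : act (A * B) w = act A (act B w) := by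
  ext <;> simp [act, Matrix.mul_apply, Fin.sum_univ_two] <;> ring

/-- Transvections `T` and `!![1, 0; 1, 1]` are realized by half-twists, and they generate the
modular group. -/
theorem exists_realizes (A : SL(2, ℤ)) :
    ∃ Φ : S3 ≃ₜ S3, OrientationPreserving Φ ∧ Realizes Φ (act A) := by
  have hinv : ∀ {A : SL(2, ℤ)}, (∃ Φ : S3 ≃ₜ S3, OrientationPreserving Φ ∧ Realizes Φ (act A)) →
      ∃ Φ : S3 ≃ₜ S3, OrientationPreserving Φ ∧ Realizes Φ (act A⁻¹) := by
    rintro A ⟨Φ, h1, h2⟩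
    exact ⟨Φ.symm, h1.symm, h2.symm fun w => by rw [← act_mul, mul_inv_cancel, act_one]⟩
  have hmul : ∀ {A B : SL(2, ℤ)},
      (∃ Φ : S3 ≃ₜ S3, OrientationPreserving Φ ∧ Realizes Φ (act A)) →
      (∃ Φ : S3 ≃ₜ S3, OrientationPreserving Φ ∧ Realizes Φ (act B)) →
      ∃ Φ : S3 ≃ₜ S3, OrientationPreserving Φ ∧ Realizes Φ (act (A * B)) := by
    rintro A B ⟨Φ, h1, h2⟩ ⟨Ψ, k1, k2⟩
    exact ⟨Ψ.trans Φ, k1.trans h1, by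
      rw [show act (A * B) = act A ∘ act B from funext (act_mul A B)]
      exact k2.trans h2⟩
  let U : SL(2, ℤ) := ⟨!![1, 0; 1, 1], by simp⟩
  have hshear : Realizes shearHomeo (fun w => (w.1 + w.2, w.2)) :=
    realizes_spreadHomeo _ _ _ _ shear_pillowE
  have hU : ∃ Φ : S3 ≃ₜ S3, OrientationPreserving Φ ∧ Realizes Φ (act U) := by
    refine ⟨shearHomeo, orientationPreserving_shearHomeo, ?_⟩
    convert! hshear using 2 with w
    simp [act, U, add_comm]
  have hT : ∃ Φ : S3 ≃ₜ S3, OrientationPreserving Φ ∧ Realizes Φ (act ModularGroup.T) := by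
    let σ := spreadHomeo isPillowMap_swap isPillowMap_swap swap_swap swap_swap
    have hσ : Realizes σ Prod.swap := realizes_spreadHomeo _ _ _ _ swap_pillowE
    refine ⟨(σ.trans shearHomeo).trans σ.symm, orientationPreserving_shearHomeo.conj σ, ?_⟩
    have h := (hσ.trans hshear).trans (hσ.symm Prod.swap_swap)
    rwa [show Prod.swap ∘ (fun w : ℝ × ℝ => (w.1 + w.2, w.2)) ∘ Prod.swap = act ModularGroup.T by
      funext w
      simp [act, ModularGroup.coe_T]] at h
  have hS : ModularGroup.S = ModularGroup.T⁻¹ * U * ModularGroup.T⁻¹ := by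
    apply Subtype.ext
    rw [Matrix.SpecialLinearGroup.coe_mul, Matrix.SpecialLinearGroup.coe_mul,
      ModularGroup.coe_T_inv, ModularGroup.coe_S]
    simp [U]
  have hA : A ∈ Subgroup.closure {ModularGroup.S, ModularGroup.T} := by
    rw [SpecialLinearGroup.SL2Z_generators]
    exact Subgroup.mem_top A
  induction hA using Subgroup.closure_induction with
  | mem B hB =>
    rcases hB with rfl | rfl
    · rw [hS]
      exact hmul (hmul (hinv hT) hU) (hinv hT)
    · exact hT
  | one =>
    exact ⟨Homeomorph.refl S3, OrientationPreserving.refl, fun w => by simp [act_one]⟩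
  | mul B C _ _ hB hC => exact hmul hB hC
  | inv B _ hB => exact hinv hB

/-! ### Slopes -/

/-- The vector `d` of the plane is zero or spans a line of slope `x`. -/
def HasSlope (x : OnePoint ℝ) (d : ℝ × ℝ) : Prop :=
  x.elim (d.1 = 0) (fun s => d.2 = s * d.1)

theorem HasSlope.act {x : OnePoint ℝ} {d : ℝ × ℝ} (h : HasSlope x d) (A : SL(2, ℤ)) :
    HasSlope (Matrix.SpecialLinearGroup.mapGL ℝ A • x) (act A d) := by
  induction x using OnePoint.rec with
  | infty =>
    have h : d.1 = 0 := h
    rw [smul_infty_eq_ite]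
    split_ifs with h0
    · have h0 : (A 1 0 : ℝ) = 0 := by simpa using h0
      simp [HasSlope, RationalLink.act, h, h0]
    · have h0 : (A 1 0 : ℝ) ≠ 0 := by simpa using h0
      simp [HasSlope, RationalLink.act, h]
      field_simp
  | coe s =>
    have h : d.2 = s * d.1 := h
    rw [smul_some_eq_ite]
    split_ifs with h0
    · have h0 : (A 1 0 : ℝ) * s + A 1 1 = 0 := by simpa using h0
      simp only [HasSlope, RationalLink.act, h, OnePoint.elim_infty]
      linear_combination d.1 * h0
    · have h0 : (A 1 0 : ℝ) * s + A 1 1 ≠ 0 := by simpa using h0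
      simp only [HasSlope, RationalLink.act, h, OnePoint.elim_some,
        Matrix.SpecialLinearGroup.mapGL_coe_matrix, Matrix.SpecialLinearGroup.map_apply_coe,
        RingHom.mapMatrix_apply, Matrix.map_apply, algebraMap_int_eq, eq_intCast]
      rw [div_mul_eq_mul_div, eq_div_iff h0]
      ring

theorem mem_latticeLines {r : OnePoint ℚ} {w : ℝ × ℝ} :
    w ∈ latticeLines r ↔ ∃ m n : ℤ, HasSlope (ideal r) (w.1 - m, w.2 - n) := by
  induction r using OnePoint.rec with
  | infty =>
    change (∃ m : ℤ, w.1 = m) ↔ ∃ m n : ℤ, w.1 - m = 0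
    simp [sub_eq_zero]
  | coe s => rfl

theorem act_mem_latticeLines {r r' : OnePoint ℚ} {A : SL(2, ℤ)}
    (h : ideal r' = Matrix.SpecialLinearGroup.mapGL ℝ A • ideal r) {w : ℝ × ℝ}
    (hw : w ∈ latticeLines r) : act A w ∈ latticeLines r' := by
  obtain ⟨m, n, hmn⟩ := mem_latticeLines.mp hw
  refine mem_latticeLines.mpr ⟨A 1 0 * n + A 1 1 * m, A 0 0 * n + A 0 1 * m, ?_⟩
  rw [h]
  convert! hmn.act A using 1
  ext <;> simp [act] <;> ring

theorem act_image_latticeLines {r r' : OnePoint ℚ} {A : SL(2, ℤ)}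
    (h : ideal r' = Matrix.SpecialLinearGroup.mapGL ℝ A • ideal r) :
    act A '' latticeLines r = latticeLines r' := by
  refine Set.Subset.antisymm ?_ fun w hw => ⟨act A⁻¹ w, ?_, ?_⟩
  · rintro _ ⟨w, hw, rfl⟩
    exact act_mem_latticeLines h hw
  · exact act_mem_latticeLines (by rw [h, smul_smul, ← map_mul, inv_mul_cancel, map_one,
      one_smul]) hw
  · rw [← act_mul, mul_inv_cancel, act_one]

theorem neg_mem_latticeLines {r : OnePoint ℚ} {w : ℝ × ℝ} (hw : w ∈ latticeLines r) (k : ℤ) :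
    ((1 - w.1, k + w.2) : ℝ × ℝ) ∈ latticeLines (negSlope r) := by
  induction r using OnePoint.rec with
  | infty =>
    obtain ⟨m, hm⟩ := hw
    exact ⟨1 - m, by simp [hm]⟩
  | coe s =>
    obtain ⟨m, n, h⟩ := hw
    exact ⟨1 - m, k + n, by push_cast; linear_combination h⟩

theorem negSlope_negSlope (r : OnePoint ℚ) : negSlope (negSlope r) = r := by
  induction r using OnePoint.rec <;> simp [negSlope]

/-! ### The covering link as a union of two rational tangles -/

/-- The antipodal map of `ℝ³` induces `(u, v) ↦ (1 - u, 1 + v)` on the pillowcase. -/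
theorem deck_pillow (w : ℝ × ℝ) :
    deck (ballIncl (pillow w)) = inv3 (ballIncl (pillow (1 - w.1, 1 + w.2))) := by
  have h : pillowE (1 - w.1, 1 + w.2) = -pillowE w := by
    ext i
    fin_cases i <;>
      simp [pillowE, mul_add, mul_sub, Real.cos_add, Real.cos_sub, Real.sin_add, Real.sin_sub]
  have hr : ratio (-pillowE w) = ratio (pillowE w) := by
    rw [ratio, ← h, gauge_pillowE, h, norm_neg, ratio, gauge_pillowE]
  rw [deck, inv3_pillow, inv3_pillow, h, hr, OnePoint.map_some, smul_neg]

theorem coveringLink_eq (r : OnePoint ℚ) : coveringLink r =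
    ballIncl '' tangle r ∪ inv3 '' (ballIncl '' tangle (negSlope r)) := by
  ext x
  have h : x ∈ coveringLink r ↔
      ∃ y ∈ tangle r, x = ballIncl y ∨ x = deck (ballIncl y) := by
    change (∃ y ∈ tangle r, toP3 y = coveringProj x) ↔ _
    simp only [eq_comm (b := coveringProj x), ← coveringProj_ballIncl, coveringProj_eq_iff]
  rw [h]
  constructor
  · rintro ⟨_, ⟨w, hw, rfl⟩, rfl | rfl⟩
    · exact Or.inl ⟨_, ⟨w, hw, rfl⟩, rfl⟩
    · have hw' := neg_mem_latticeLines hw 1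
      rw [Int.cast_one] at hw'
      exact Or.inr ⟨_, ⟨_, ⟨_, hw', rfl⟩, rfl⟩, (deck_pillow w).symm⟩
  · rintro (⟨y, hy, rfl⟩ | ⟨_, ⟨_, ⟨w, hw, rfl⟩, rfl⟩, rfl⟩)
    · exact ⟨y, hy, Or.inl rfl⟩
    · have hw' := neg_mem_latticeLines hw (-1)
      rw [negSlope_negSlope] at hw'
      exact ⟨_, ⟨_, hw', rfl⟩, Or.inr (by rw [deck_pillow]; simp)⟩

/-- The modular group acts on the unions of a rational tangle in the ball and the image of
another one under the inversion. -/
theorem linkEquivalent_of_smul {r s r' s' : OnePoint ℚ} {A : SL(2, ℤ)}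
    (hr : ideal r' = Matrix.SpecialLinearGroup.mapGL ℝ A • ideal r)
    (hs : ideal s' = Matrix.SpecialLinearGroup.mapGL ℝ A • ideal s) :
    LinkEquivalent (ballIncl '' tangle r ∪ inv3 '' (ballIncl '' tangle s))
      (ballIncl '' tangle r' ∪ inv3 '' (ballIncl '' tangle s')) := by
  obtain ⟨Φ, hΦ, h⟩ := exists_realizes A
  refine ⟨Φ, hΦ, ?_⟩
  simp only [tangle, Set.image_union, Set.image_image, ← act_image_latticeLines hr,
    ← act_image_latticeLines hs, (h _).1, (h _).2]

/-! ### Automorphisms of the Farey tessellation -/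

open Matrix.SpecialLinearGroup (mapGL)
/-- The set of ideal vertices of the triangle from which the Farey tessellation is generated. -/
def baseTriangle : Set (OnePoint ℝ) := {((0 : ℝ) : OnePoint ℝ), ((1 : ℝ) : OnePoint ℝ), ∞}

theorem IsReflection.symm {g : GL (Fin 2) ℝ} {a b : OnePoint ℝ} (h : IsReflection g a b) :
    IsReflection g b a :=
  ⟨h.1, h.2.1, h.2.2.2, h.2.2.1⟩

theorem IsReflection.conj {g : GL (Fin 2) ℝ} {a b : OnePoint ℝ} (h : IsReflection g a b)
    (γ : GL (Fin 2) ℝ) : IsReflection (γ * g * γ⁻¹) (γ • a) (γ • b) := by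
  obtain ⟨h1, h2, h3, h4⟩ := h
  refine ⟨?_, fun x => ?_, ?_, ?_⟩
  · have : (γ * g * γ⁻¹).det = g.det := by
      rw [map_mul, map_mul, map_inv, mul_comm, inv_mul_cancel_left]
    rwa [this]
  · simp only [mul_smul, inv_smul_smul, h2, smul_inv_smul]
  · rw [mul_smul, mul_smul, inv_smul_smul, h3]
  · rw [mul_smul, mul_smul, inv_smul_smul, h4]

theorem IsFareyTriangle.smul {γ : GL (Fin 2) ℝ} (hγ : IsFareyTriangle (γ • baseTriangle))
    {T : Set (OnePoint ℝ)} (hT : IsFareyTriangle T) : IsFareyTriangle (γ • T) := by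
  induction hT with
  | base => exact hγ
  | @reflect T a b g hT ha hb hab hg ih =>
    have h : γ • g • T = (γ * g * γ⁻¹) • γ • T := by
      simp only [smul_smul, inv_mul_cancel_right]
    rw [h]
    exact .reflect ih (Set.smul_mem_smul_set ha) (Set.smul_mem_smul_set hb)
      (fun e => hab (smul_left_cancel γ e)) (hg.conj γ)

theorem mem_stabilizer_of_isFareyTriangle {γ : GL (Fin 2) ℝ}
    (h : IsFareyTriangle (γ • baseTriangle)) (h' : IsFareyTriangle (γ⁻¹ • baseTriangle)) :
    γ ∈ MulAction.stabilizer (GL (Fin 2) ℝ) {T : Set (OnePoint ℝ) | IsFareyTriangle T} := by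
  rw [MulAction.mem_stabilizer_iff]
  ext T
  rw [Set.mem_smul_set_iff_inv_smul_mem]
  refine ⟨fun hT => ?_, fun hT => h'.smul hT⟩
  simpa using h.smul hT

theorem smul_baseTriangle (g : GL (Fin 2) ℝ) : g • baseTriangle =
    {g • ((0 : ℝ) : OnePoint ℝ), g • ((1 : ℝ) : OnePoint ℝ), g • ∞} := by
  simp only [baseTriangle, Set.smul_set_insert, Set.smul_set_singleton]

theorem isFareyTriangle_neg_one :
    IsFareyTriangle {((0 : ℝ) : OnePoint ℝ), ((-1 : ℝ) : OnePoint ℝ), ∞} := by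
  let g : GL (Fin 2) ℝ := Matrix.GeneralLinearGroup.mkOfDetNeZero !![-1, 0; 0, 1] (by simp)
  have h0 : g • ((0 : ℝ) : OnePoint ℝ) = ((0 : ℝ) : OnePoint ℝ) := by
    simp [g, smul_some_eq_ite, Matrix.GeneralLinearGroup.mkOfDetNeZero]
  have h1 : g • ((1 : ℝ) : OnePoint ℝ) = ((-1 : ℝ) : OnePoint ℝ) := by
    simp [g, smul_some_eq_ite, Matrix.GeneralLinearGroup.mkOfDetNeZero]
  have h2 : g • (∞ : OnePoint ℝ) = ∞ := by
    simp [g, smul_infty_eq_ite, Matrix.GeneralLinearGroup.mkOfDetNeZero]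
  have h3 : g * g = 1 := by
    ext i j
    fin_cases i <;> fin_cases j <;>
      simp [g, Matrix.GeneralLinearGroup.mkOfDetNeZero, Matrix.mul_apply]
  have h := IsFareyTriangle.base.reflect (a := ((0 : ℝ) : OnePoint ℝ)) (b := ∞) (g := g)
    (by simp) (by simp) (by simp)
    ⟨by simp [g, Matrix.GeneralLinearGroup.mkOfDetNeZero], fun x => by rw [smul_smul, h3, one_smul],
      h0, h2⟩
  have e := smul_baseTriangle g
  rw [baseTriangle] at e
  rwa [e, h0, h1, h2] at h

theorem isFareyTriangle_two :
    IsFareyTriangle {((2 : ℝ) : OnePoint ℝ), ((1 : ℝ) : OnePoint ℝ), ∞} := by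
  let g : GL (Fin 2) ℝ := Matrix.GeneralLinearGroup.mkOfDetNeZero !![-1, 2; 0, 1] (by simp)
  have h0 : g • ((0 : ℝ) : OnePoint ℝ) = ((2 : ℝ) : OnePoint ℝ) := by
    simp [g, smul_some_eq_ite, Matrix.GeneralLinearGroup.mkOfDetNeZero]
  have h1 : g • ((1 : ℝ) : OnePoint ℝ) = ((1 : ℝ) : OnePoint ℝ) := by
    simp [g, smul_some_eq_ite, Matrix.GeneralLinearGroup.mkOfDetNeZero]
    norm_num
  have h2 : g • (∞ : OnePoint ℝ) = ∞ := by
    simp [g, smul_infty_eq_ite, Matrix.GeneralLinearGroup.mkOfDetNeZero]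
  have h3 : g * g = 1 := by
    ext i j
    fin_cases i <;> fin_cases j <;>
      simp [g, Matrix.GeneralLinearGroup.mkOfDetNeZero, Matrix.mul_apply]
  have h := IsFareyTriangle.base.reflect (a := ((1 : ℝ) : OnePoint ℝ)) (b := ∞) (g := g)
    (by simp) (by simp) (by simp)
    ⟨by simp [g, Matrix.GeneralLinearGroup.mkOfDetNeZero], fun x => by rw [smul_smul, h3, one_smul],
      h1, h2⟩
  have e := smul_baseTriangle g
  rw [baseTriangle] at e
  rwa [e, h0, h1, h2] at h

theorem mapGL_T_smul (x : ℝ) :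
    mapGL ℝ ModularGroup.T • (x : OnePoint ℝ) = ((x + 1 : ℝ) : OnePoint ℝ) := by
  simp [smul_some_eq_ite, ModularGroup.coe_T]

theorem mapGL_T_smul_infty : mapGL ℝ ModularGroup.T • (∞ : OnePoint ℝ) = ∞ := by
  simp [smul_infty_eq_ite, ModularGroup.coe_T]

theorem mapGL_S_smul_infty :
    mapGL ℝ ModularGroup.S • (∞ : OnePoint ℝ) = ((0 : ℝ) : OnePoint ℝ) := by
  simp [smul_infty_eq_ite, ModularGroup.coe_S]

theorem mapGL_S_smul_zero : mapGL ℝ ModularGroup.S • ((0 : ℝ) : OnePoint ℝ) = ∞ := by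
  simp [smul_some_eq_ite, ModularGroup.coe_S]

theorem mapGL_S_smul {x : ℝ} (hx : x ≠ 0) :
    mapGL ℝ ModularGroup.S • (x : OnePoint ℝ) = ((-1 / x : ℝ) : OnePoint ℝ) := by
  simp [smul_some_eq_ite, ModularGroup.coe_S, hx]

theorem mapGL_S_smul_one :
    mapGL ℝ ModularGroup.S • ((1 : ℝ) : OnePoint ℝ) = ((-1 : ℝ) : OnePoint ℝ) := by
  rw [mapGL_S_smul one_ne_zero, div_one]

theorem mapGL_S_smul_neg_one :
    mapGL ℝ ModularGroup.S • ((-1 : ℝ) : OnePoint ℝ) = ((1 : ℝ) : OnePoint ℝ) := by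
  rw [mapGL_S_smul (neg_ne_zero.mpr one_ne_zero), div_self (neg_ne_zero.mpr one_ne_zero)]

theorem mapGL_T_smul_baseTriangle : mapGL ℝ ModularGroup.T • baseTriangle =
    {((2 : ℝ) : OnePoint ℝ), ((1 : ℝ) : OnePoint ℝ), ∞} := by
  rw [smul_baseTriangle, mapGL_T_smul, mapGL_T_smul, mapGL_T_smul_infty, zero_add,
    one_add_one_eq_two, Set.insert_comm]

theorem mapGL_T_inv_smul_baseTriangle : (mapGL ℝ ModularGroup.T)⁻¹ • baseTriangle =
    {((0 : ℝ) : OnePoint ℝ), ((-1 : ℝ) : OnePoint ℝ), ∞} := by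
  rw [inv_smul_eq_iff, baseTriangle]
  simp only [Set.smul_set_insert, Set.smul_set_singleton, mapGL_T_smul, mapGL_T_smul_infty,
    zero_add, neg_add_cancel]
  exact Set.insert_comm _ _ _

/-- The modular group preserves the Farey tessellation. -/
theorem mapGL_mem_fareyAutPos (A : SL(2, ℤ)) : mapGL ℝ A ∈ fareyAutPos := by
  refine ⟨?_, ?_⟩
  · have hle : Subgroup.closure {ModularGroup.S, ModularGroup.T} ≤
        (MulAction.stabilizer (GL (Fin 2) ℝ) {T : Set (OnePoint ℝ) | IsFareyTriangle T}).comap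
          (mapGL ℝ) := by
      rw [Subgroup.closure_le]
      rintro _ (rfl | rfl)
      · have h : {∞, ((-1 : ℝ) : OnePoint ℝ), ((0 : ℝ) : OnePoint ℝ)} =
            ({((0 : ℝ) : OnePoint ℝ), ((-1 : ℝ) : OnePoint ℝ), ∞} : Set (OnePoint ℝ)) := by
          ext x
          simp only [Set.mem_insert_iff, Set.mem_singleton_iff]
          tauto
        refine mem_stabilizer_of_isFareyTriangle ?_ ?_
        · rw [smul_baseTriangle, mapGL_S_smul_zero, mapGL_S_smul_one, mapGL_S_smul_infty, h]
          exact isFareyTriangle_neg_one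
        · rw [show (mapGL ℝ ModularGroup.S)⁻¹ • baseTriangle =
              {∞, ((-1 : ℝ) : OnePoint ℝ), ((0 : ℝ) : OnePoint ℝ)} by
            rw [inv_smul_eq_iff]
            simp only [Set.smul_set_insert, Set.smul_set_singleton, mapGL_S_smul_zero,
              mapGL_S_smul_neg_one, mapGL_S_smul_infty, baseTriangle], h]
          exact isFareyTriangle_neg_one
      · refine mem_stabilizer_of_isFareyTriangle ?_ ?_
        · rw [mapGL_T_smul_baseTriangle]
          exact isFareyTriangle_two
        · rw [mapGL_T_inv_smul_baseTriangle]
          exact isFareyTriangle_neg_one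
    rw [SpecialLinearGroup.SL2Z_generators] at hle
    exact hle (Subgroup.mem_top A)
  · simp [Matrix.GLPos, Units.posSubgroup]

theorem smul_coe_eq_coe {g : GL (Fin 2) ℝ} {x y : ℝ} :
    g • (x : OnePoint ℝ) = (y : OnePoint ℝ) ↔
      g 1 0 * x + g 1 1 ≠ 0 ∧ g 0 0 * x + g 0 1 = y * (g 1 0 * x + g 1 1) := by
  rw [smul_some_eq_ite]
  split_ifs with h
  · simp [h]
  · rw [OnePoint.coe_eq_coe, div_eq_iff h]
    simp [h]

theorem det_eq (g : GL (Fin 2) ℝ) : g.det.val = g 0 0 * g 1 1 - g 0 1 * g 1 0 := by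
  rw [Matrix.GeneralLinearGroup.val_det_apply, Matrix.det_fin_two]

/-- A reflection has trace zero, since it is an involution on the ideal boundary. -/
theorem IsReflection.trace {g : GL (Fin 2) ℝ} {a b : OnePoint ℝ} (h : IsReflection g a b) :
    g 0 0 + g 1 1 = 0 := by
  obtain ⟨hd, hg, -, -⟩ := h
  rw [det_eq] at hd
  have hg2 : ∀ x : OnePoint ℝ, (g * g) • x = x := fun x => by rw [mul_smul, hg]
  have e10 : g 1 0 * (g 0 0 + g 1 1) = 0 := by
    have h := smul_infty_eq_self_iff.mp (hg2 ∞)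
    rw [Units.val_mul, Matrix.mul_apply, Fin.sum_univ_two] at h
    linarith
  have e01 : g 0 1 * (g 0 0 + g 1 1) = 0 := by
    have h := (smul_coe_eq_coe.mp (hg2 ((0 : ℝ) : OnePoint ℝ))).2
    simp only [Units.val_mul, Matrix.mul_apply, Fin.sum_univ_two] at h
    linarith
  have e1 := (smul_coe_eq_coe.mp (hg2 ((1 : ℝ) : OnePoint ℝ))).2
  simp only [Units.val_mul, Matrix.mul_apply, Fin.sum_univ_two] at e1
  by_contra ht
  have h10 := (mul_eq_zero.mp e10).resolve_right ht
  have h01 := (mul_eq_zero.mp e01).resolve_right ht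
  rw [h10, h01] at e1 hd
  have h : g 0 0 = g 1 1 := by
    have : (g 0 0 - g 1 1) * (g 0 0 + g 1 1) = 0 := by linarith
    linarith [(mul_eq_zero.mp this).resolve_right ht]
  rw [h] at hd
  nlinarith [sq_nonneg (g 1 1)]

theorem IsReflection.exists_smul_baseTriangle_eq {g : GL (Fin 2) ℝ} {a b : OnePoint ℝ}
    (h : IsReflection g a b) (ha : a ∈ baseTriangle) (hb : b ∈ baseTriangle) (hab : a ≠ b) :
    ∃ A : SL(2, ℤ), g • baseTriangle = mapGL ℝ A • baseTriangle := by
  have h0i : ∀ {g : GL (Fin 2) ℝ}, IsReflection g ((0 : ℝ) : OnePoint ℝ) ∞ →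
      ∃ A : SL(2, ℤ), g • baseTriangle = mapGL ℝ A • baseTriangle := by
    intro g h
    have ht := h.trace
    obtain ⟨hd, -, h0, hi⟩ := h
    have hc := smul_infty_eq_self_iff.mp hi
    have hb := (smul_coe_eq_coe.mp h0).2
    have hd0 := (smul_coe_eq_coe.mp h0).1
    refine ⟨ModularGroup.T⁻¹, ?_⟩
    have h1 : g • ((1 : ℝ) : OnePoint ℝ) = ((-1 : ℝ) : OnePoint ℝ) := by
      rw [smul_coe_eq_coe, hc]
      constructor
      · simpa using hd0
      · linarith
    rw [map_inv, mapGL_T_inv_smul_baseTriangle, smul_baseTriangle, h0, h1, hi]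
  have h1i : ∀ {g : GL (Fin 2) ℝ}, IsReflection g ((1 : ℝ) : OnePoint ℝ) ∞ →
      ∃ A : SL(2, ℤ), g • baseTriangle = mapGL ℝ A • baseTriangle := by
    intro g h
    have ht := h.trace
    obtain ⟨hd, -, h1, hi⟩ := h
    have hc := smul_infty_eq_self_iff.mp hi
    obtain ⟨hd0, hb⟩ := smul_coe_eq_coe.mp h1
    rw [hc] at hd0 hb
    refine ⟨ModularGroup.T, ?_⟩
    have h0 : g • ((0 : ℝ) : OnePoint ℝ) = ((2 : ℝ) : OnePoint ℝ) := by
      rw [smul_coe_eq_coe, hc]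
      constructor
      · simpa using hd0
      · linarith
    rw [mapGL_T_smul_baseTriangle, smul_baseTriangle, h0, h1, hi]
  have h01 : ∀ {g : GL (Fin 2) ℝ}, IsReflection g ((0 : ℝ) : OnePoint ℝ) ((1 : ℝ) : OnePoint ℝ) →
      ∃ A : SL(2, ℤ), g • baseTriangle = mapGL ℝ A • baseTriangle := by
    intro g h
    have ht := h.trace
    obtain ⟨hd, -, h0, h1⟩ := h
    obtain ⟨hd0, hb⟩ := smul_coe_eq_coe.mp h0
    obtain ⟨hd1, ha⟩ := smul_coe_eq_coe.mp h1
    have hd0' : g 1 1 ≠ 0 := by simpa using hd0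
    have hc : g 1 0 = -2 * g 1 1 := by linarith
    have hi : g • (∞ : OnePoint ℝ) = ((1 / 2 : ℝ) : OnePoint ℝ) := by
      rw [smul_infty_eq_ite, if_neg (by simpa [hc] using hd0'), OnePoint.coe_eq_coe, hc,
        show g 0 0 = -g 1 1 by linarith]
      field_simp
    -- The product `T * S * T = !![1, 0; 1, 1]` maps the vertices `0, 1, ∞` to `0, 1 / 2, 1`.
    refine ⟨ModularGroup.T * ModularGroup.S * ModularGroup.T, ?_⟩
    have hU : ∀ x : OnePoint ℝ,
        mapGL ℝ (ModularGroup.T * ModularGroup.S * ModularGroup.T) • x =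
          mapGL ℝ ModularGroup.T • mapGL ℝ ModularGroup.S • mapGL ℝ ModularGroup.T • x := by
      intro x
      simp only [map_mul, smul_smul, mul_assoc]
    have u0 := hU ((0 : ℝ) : OnePoint ℝ)
    have u1 := hU ((1 : ℝ) : OnePoint ℝ)
    have ui := hU ∞
    rw [mapGL_T_smul, zero_add, mapGL_S_smul_one, mapGL_T_smul, neg_add_cancel] at u0
    rw [mapGL_T_smul, mapGL_S_smul (by norm_num), mapGL_T_smul,
      show -1 / (1 + 1) + 1 = (1 / 2 : ℝ) by norm_num] at u1
    rw [mapGL_T_smul_infty, mapGL_S_smul_infty, mapGL_T_smul, zero_add] at ui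
    rw [smul_baseTriangle, smul_baseTriangle, h0, h1, hi, u0, u1, ui,
      Set.pair_comm ((1 : ℝ) : OnePoint ℝ)]
  rcases ha with rfl | rfl | rfl <;> rcases hb with rfl | rfl | rfl
  · exact absurd rfl hab
  · exact h01 h
  · exact h0i h
  · exact h01 h.symm
  · exact absurd rfl hab
  · exact h1i h
  · exact h0i h.symm
  · exact h1i h.symm
  · exact absurd rfl hab

/-- The modular group acts transitively on the Farey triangles. -/
theorem IsFareyTriangle.exists_eq_smul {T : Set (OnePoint ℝ)} (hT : IsFareyTriangle T) :
    ∃ A : SL(2, ℤ), T = mapGL ℝ A • baseTriangle := by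
  induction hT with
  | base => exact ⟨1, by rw [map_one, one_smul, baseTriangle]⟩
  | @reflect T a b g hT ha hb hab hg ih =>
    obtain ⟨A, rfl⟩ := ih
    have h := hg.conj (mapGL ℝ A)⁻¹
    obtain ⟨B, hB⟩ := h.exists_smul_baseTriangle_eq (Set.mem_smul_set_iff_inv_smul_mem.mp ha)
      (Set.mem_smul_set_iff_inv_smul_mem.mp hb) fun e => hab (smul_left_cancel _ e)
    refine ⟨A * B, ?_⟩
    rw [map_mul, ← smul_smul, ← hB]
    simp only [smul_smul, inv_inv]
    congr 1
    group

/-- A Möbius transformation that preserves the orientation, the base triangle and one of its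
vertices is trivial. -/
theorem smul_eq_self_of_baseTriangle {g : GL (Fin 2) ℝ} (hd : 0 < g.det.val)
    (hg : g • baseTriangle = baseTriangle) (hi : g • (∞ : OnePoint ℝ) = ∞) (x : OnePoint ℝ) :
    g • x = x := by
  rw [det_eq] at hd
  have hc := smul_infty_eq_self_iff.mp hi
  have hm : ∀ y : ℝ, (y : OnePoint ℝ) ∈ baseTriangle →
      g • (y : OnePoint ℝ) = ((0 : ℝ) : OnePoint ℝ) ∨
        g • (y : OnePoint ℝ) = ((1 : ℝ) : OnePoint ℝ) := by
    intro y hy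
    have h : g • (y : OnePoint ℝ) ∈ baseTriangle := by
      rw [← hg]
      exact Set.smul_mem_smul_set hy
    rcases h with h | h | h
    · exact Or.inl h
    · exact Or.inr h
    · exact absurd (smul_left_cancel g (h.trans hi.symm)) (OnePoint.coe_ne_infty y)
  rw [hc, mul_zero, sub_zero] at hd
  have key : g 0 1 = 0 ∧ g 0 0 = g 1 1 := by
    rcases hm 0 (by simp [baseTriangle]) with h0 | h0 <;>
      rcases hm 1 (by simp [baseTriangle]) with h1 | h1 <;>
      have e0 := (smul_coe_eq_coe.mp h0).2 <;> have e1 := (smul_coe_eq_coe.mp h1).2 <;>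
      rw [hc] at e0 e1
    · have : g 0 0 = 0 := by linarith
      simp [this] at hd
    · constructor <;> linarith
    · have : g 0 0 = -g 1 1 := by linarith
      rw [this] at hd
      nlinarith [sq_nonneg (g 1 1)]
    · have : g 0 0 = 0 := by linarith
      simp [this] at hd
  induction x using OnePoint.rec with
  | infty => exact hi
  | coe x =>
    have h1 : g 1 1 ≠ 0 := by
      intro h
      simp [h] at hd
    rw [smul_coe_eq_coe, hc, key.1, key.2]
    exact ⟨by simpa using h1, by ring⟩

/-- The stabilizer of the base triangle in the modular group is transitive on its vertices. -/
theorem exists_smul_infty_eq {x : OnePoint ℝ} (hx : x ∈ baseTriangle) :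
    ∃ A : SL(2, ℤ), mapGL ℝ A • baseTriangle = baseTriangle ∧ mapGL ℝ A • ∞ = x := by
  -- The element `x ↦ 1 / (1 - x)` rotates the base triangle.
  let R : SL(2, ℤ) := ModularGroup.S * ModularGroup.T⁻¹
  have hRx : ∀ x y : OnePoint ℝ, mapGL ℝ ModularGroup.T • y = x →
      mapGL ℝ R • x = mapGL ℝ ModularGroup.S • y := by
    rintro _ y rfl
    rw [map_mul, map_inv, mul_smul, inv_smul_smul]
  have r0 : mapGL ℝ R • ((0 : ℝ) : OnePoint ℝ) = ((1 : ℝ) : OnePoint ℝ) := by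
    rw [hRx _ ((-1 : ℝ) : OnePoint ℝ) (by rw [mapGL_T_smul, neg_add_cancel]),
      mapGL_S_smul_neg_one]
  have r1 : mapGL ℝ R • ((1 : ℝ) : OnePoint ℝ) = ∞ := by
    rw [hRx _ ((0 : ℝ) : OnePoint ℝ) (by rw [mapGL_T_smul, zero_add]), mapGL_S_smul_zero]
  have ri : mapGL ℝ R • (∞ : OnePoint ℝ) = ((0 : ℝ) : OnePoint ℝ) := by
    rw [hRx _ ∞ mapGL_T_smul_infty, mapGL_S_smul_infty]
  have hR : mapGL ℝ R • baseTriangle = baseTriangle := by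
    rw [smul_baseTriangle, r0, r1, ri, baseTriangle]
    ext x
    simp only [Set.mem_insert_iff, Set.mem_singleton_iff]
    tauto
  rcases hx with rfl | rfl | rfl
  · exact ⟨R, hR, ri⟩
  · exact ⟨R * R, by rw [map_mul, ← smul_smul, hR, hR], by rw [map_mul, ← smul_smul, ri, r0]⟩
  · exact ⟨1, by rw [map_one, one_smul], by rw [map_one, one_smul]⟩

/-- The orientation-preserving automorphisms of the Farey tessellation act on the ideal boundary
as elements of the modular group. -/
theorem exists_mapGL_smul_eq {η : GL (Fin 2) ℝ} (hη : η ∈ fareyAutPos) :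
    ∃ A : SL(2, ℤ), ∀ x : OnePoint ℝ, η • x = mapGL ℝ A • x := by
  obtain ⟨h1, h2⟩ := hη
  have hT : IsFareyTriangle (η • baseTriangle) := by
    have h : η • baseTriangle ∈ η • {T : Set (OnePoint ℝ) | IsFareyTriangle T} :=
      Set.smul_mem_smul_set IsFareyTriangle.base
    rwa [MulAction.mem_stabilizer_iff.mp h1] at h
  obtain ⟨A, hA⟩ := hT.exists_eq_smul
  have hm : (mapGL ℝ A)⁻¹ • η • (∞ : OnePoint ℝ) ∈ baseTriangle := by
    rw [← Set.mem_smul_set_iff_inv_smul_mem, ← hA]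
    exact Set.smul_mem_smul_set (by simp [baseTriangle])
  obtain ⟨B, hB, hBi⟩ := exists_smul_infty_eq hm
  refine ⟨A * B, fun x => ?_⟩
  have hpos : (mapGL ℝ (A * B))⁻¹ * η ∈ Matrix.GLPos (Fin 2) ℝ :=
    mul_mem (inv_mem (mapGL_mem_fareyAutPos _).2) h2
  have h := smul_eq_self_of_baseTriangle (g := (mapGL ℝ (A * B))⁻¹ * η) hpos
    (by rw [← smul_smul, inv_smul_eq_iff, hA, map_mul, ← smul_smul, hB])
    (by rw [← smul_smul, inv_smul_eq_iff, map_mul, ← smul_smul, hBi, smul_inv_smul]) x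
  rwa [← smul_smul, inv_smul_eq_iff] at h

theorem ideal_smul (A : SL(2, ℤ)) (r : OnePoint ℚ) :
    ideal (mapGL ℚ A • r) = mapGL ℝ A • ideal r := by
  have h := OnePoint.map_smul (Rat.castHom ℝ) (mapGL ℚ A) r
  have h' : Matrix.GeneralLinearGroup.map (Rat.castHom ℝ) (mapGL ℚ A) = mapGL ℝ A := by
    ext i j
    simp
  rwa [h'] at h

end RationalLink

end
theorem mainTheorem8 (r : OnePoint ℚ) :
    (∃ η ∈ RationalLink.fareyAutPos,
      η • RationalLink.ideal (RationalLink.negSlope r) = (OnePoint.infty : OnePoint ℝ)) ∧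
    ∀ η ∈ RationalLink.fareyAutPos,
      η • RationalLink.ideal (RationalLink.negSlope r) = (OnePoint.infty : OnePoint ℝ) →
      ∃ r' : OnePoint ℚ, RationalLink.ideal r' = η • RationalLink.ideal r ∧
        RationalLink.LinkEquivalent (RationalLink.coveringLink r) (RationalLink.twoBridge r') := by
  constructor
  · obtain ⟨A, hA⟩ := OnePoint.exists_mem_SL2 ℤ (RationalLink.negSlope r)
    refine ⟨_, RationalLink.mapGL_mem_fareyAutPos A⁻¹, ?_⟩
    rw [← RationalLink.ideal_smul, ← hA, smul_smul, ← map_mul, inv_mul_cancel, map_one, one_smul]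
    rfl
  · intro η hη h
    obtain ⟨A, hA⟩ := RationalLink.exists_mapGL_smul_eq hη
    refine ⟨Matrix.SpecialLinearGroup.mapGL ℚ A • r, ?_, ?_⟩
    · rw [RationalLink.ideal_smul, hA]
    · rw [RationalLink.coveringLink_eq, RationalLink.twoBridge]
      refine RationalLink.linkEquivalent_of_smul (RationalLink.ideal_smul A r) ?_
      rw [← hA, h]
      rfl
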